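/- **Polyhedra.** An embedded polyhedron $M\subset\mathbb R^3$ is given by a countable collection $K$ of cells, each of which is a point (0-cell, vertex), a nondegenerate closed segment (1-cell, edge) or a closed convex plane polygon (2-cell, face), such that: the relative boundary of every cell is a union of cells of lower degree; distinct cells have disjoint relative interiors; $K$ is locally finite, i.e. every point of $\mathbb R^3$ has a neighbourhood that meets only finitely many cells; and, for every $p\in M=\bigcup K$, the open star of $p$ (the union of the relative interiors of the cells containing $p$) is homeomorphic to an open disc. Write $\mathrm{Star}(p)$ for the union of all cells containing $p$. Let $\Gamma\subset\mathbb R^3$ be a discrete subgroup of rank 3, and let $M$ be a triply periodic polyhedron with respect to $\Gamma$: $C+\gamma\in K$ for all $C\in K$, $\gamma\in\Gamma$. The quotient polyhedron $\mathcal M=M/\Gamma\subset\mathbb R^3/\Gamma$ has as its $r$-cells the images of the $r$-cells of $M$, and its Euler characteristic is $\chi(\mathcal M)=V-E+F$, the alternating sum of the numbers of its cells of degree $0,1,2$. **Index.** Let $\omega=h^1dp_1+h^2dp_2+h^3dp_3$ be a constant 1-form, identified with the linear function $p\mapsto\sum_\alpha h^\alpha p_\alpha$; its leaf through $p\in M$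 is $\{x\in M:\omega(x)=\omega(p)\}$. The form $\omega$ is generic for $M$ if no edge of $M$ is contained in a single leaf. For $p\in M$ put $i(p,\omega)=1-s/2$, where $s$ is the number of segments with $p$ as an extreme into which the leaf through $p$ cuts $\mathrm{Star}(p)$, that is, of maximal nondegenerate segments $[p,q]$ contained in that leaf and in $\mathrm{Star}(p)$. **Theorem.** Suppose that $\omega$ is generic for $M$. Then $\mathcal M$ has finitely many cells, and for every complete set $S$ of pairwise $\Gamma$-inequivalent vertices of $M$ (one vertex from each $\Gamma$-class), $S$ is finite and $$\sum_{p\in S} i(p,\omega)=\chi(\mathcal M).$$ Moreover, every ball contains only finitely many vertices of $M$, and, with $\mathrm{Vol}$ normalized so that the Dirichlet domain $\{x:\|x\|\le\|x-\gamma\|\ \forall\gamma\in\Gamma\}$ of $\Gamma$ has volume $1$ (i.e. $\mathrm{Vol}$ is Lebesgue measure divided by the Lebesgue measure of the Dirichlet domain), $$\lim_{R\to\infty}\frac{1}{\mathrm{Vol}(B_R)}\sum_{p\ \text{vertex of}\ M,\ \|p\|<R} i(p,\omega)=\chi(\mathcal M),$$ where $B_R$ is the open ball of radius $R$ centred at the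 origin. -/

import Mathlib

open Filter Topology MeasureTheory

/-- Euclidean three-space. -/
abbrev Space3 : Type := EuclideanSpace ℝ (Fin 3)

/-- The dimension (degree) of a cell: the dimension of its affine hull. -/
noncomputable def cellDim (C : Set Space3) : ℕ := Module.finrank ℝ (vectorSpan ℝ C)

/-- A convex cell of degree at most two: the convex hull of a nonempty finite set, i.e. a point
(degree 0), a closed segment (degree 1) or a closed convex plane polygon (degree 2). -/
def IsConvexCell (C : Set Space3) : Prop :=
  (∃ s : Set Space3, s.Finite ∧ s.Nonempty ∧ C = convexHull ℝ s) ∧ cellDim C ≤ 2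

/-- The (closed) star of `p`: the union of all cells of `K` that contain `p`. -/
def closedStar (K : Set (Set Space3)) (p : Space3) : Set Space3 :=
  ⋃ C ∈ {C ∈ K | p ∈ C}, C

/-- The open star of `p`: the union of the relative interiors of all cells of `K` that
contain `p`. -/
def openStar (K : Set (Set Space3)) (p : Space3) : Set Space3 :=
  ⋃ C ∈ {C ∈ K | p ∈ C}, intrinsicInterior ℝ C

/-- An embedded polyhedron in `ℝ³`: a countable, locally finite complex of points, segments and
convex plane polygons whose support is a surface. -/
structure EmbeddedPolyhedron where
  /-- the collection of cells -/
  cells : Set (Set Space3)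
  countable_cells : cells.Countable
  isConvexCell : ∀ C ∈ cells, IsConvexCell C
  /-- The (relative) boundary of any cell is a union of cells of lower degree. -/
  boundary_eq : ∀ C ∈ cells, ∃ T ⊆ cells, (∀ D ∈ T, cellDim D < cellDim C) ∧
    intrinsicFrontier ℝ C = ⋃₀ T
  /-- Distinct cells have disjoint relative interiors. -/
  disjoint_interior : ∀ C ∈ cells, ∀ D ∈ cells, C ≠ D →
    Disjoint (intrinsicInterior ℝ C) (intrinsicInterior ℝ D)
  /-- Every point of space has a neighbourhood that meets only finitely many cells. -/
  locallyFinite : ∀ x : Space3, ∃ U ∈ 𝓝 x, {C ∈ cells | (C ∩ U).Nonempty}.Finite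
  /-- The open star of every point of the support is homeomorphic to an open disc. -/
  star_disc : ∀ p ∈ ⋃₀ cells,
    Nonempty (openStar cells p ≃ₜ Metric.ball (0 : EuclideanSpace ℝ (Fin 2)) 1)

namespace EmbeddedPolyhedron

/-- The vertices: the points that are 0-cells. -/
def vertices (M : EmbeddedPolyhedron) : Set Space3 := {p | {p} ∈ M.cells}

/-- Invariance of the polyhedron (that is, of its collection of cells) under translation by the
elements of `Γ`. -/
def IsInvariant (M : EmbeddedPolyhedron) (Γ : Submodule ℤ Space3) : Prop :=
  ∀ γ ∈ Γ, ∀ C ∈ M.cells, (fun x => γ + x) '' C ∈ M.cells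

/-- The support of the polyhedron, as a subset of `ℝ³`. -/
def support (M : EmbeddedPolyhedron) : Set Space3 := ⋃₀ M.cells

/-- The leaf through `p` that the constant 1-form `ω` induces on the polyhedron: the intersection
of the polyhedron with the plane `ω = ω p`. -/
def leaf (M : EmbeddedPolyhedron) (ω : Space3 →ₗ[ℝ] ℝ) (p : Space3) : Set Space3 :=
  {x ∈ M.support | ω x = ω p}

/-- `ω` is generic: no edge is contained in a single leaf of `ω`. -/
def IsGeneric (M : EmbeddedPolyhedron) (ω : Space3 →ₗ[ℝ] ℝ) : Prop :=
  ∀ C ∈ M.cells, cellDim C = 1 → ¬ ∃ c : ℝ, ∀ x ∈ C, ω x = c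

/-- The segments with `p` as an extreme into which the leaf through `p` cuts the star of `p`:
the maximal nondegenerate segments issuing from `p` that lie in the leaf and in the star. -/
def cutSegments (M : EmbeddedPolyhedron) (ω : Space3 →ₗ[ℝ] ℝ) (p : Space3) :
    Set (Set Space3) :=
  {S | Maximal (fun T => (∃ q : Space3, q ≠ p ∧ T = segment ℝ p q) ∧
    T ⊆ closedStar M.cells p ∩ M.leaf ω p) S}

/-- The index `i(p, ω) = 1 - s / 2`. -/
noncomputable def index (M : EmbeddedPolyhedron) (ω : Space3 →ₗ[ℝ] ℝ) (p : Space3) : ℝ :=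
  1 - ((M.cutSegments ω p).ncard : ℝ) / 2

/-- The `r`-cells of the quotient polyhedron `M / Γ` in the torus `ℝ³ / Γ`: the images of the
`r`-cells of `M`. -/
def quotientCells (M : EmbeddedPolyhedron) (Γ : Submodule ℤ Space3) (r : ℕ) :
    Set (Set (Space3 ⧸ Γ)) :=
  (fun C => Γ.mkQ '' C) '' {C ∈ M.cells | cellDim C = r}

/-- The Euler characteristic `V - E + F` of the quotient polyhedron `M / Γ`. -/
noncomputable def quotientEulerChar (M : EmbeddedPolyhedron) (Γ : Submodule ℤ Space3) : ℤ :=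
  ((M.quotientCells Γ 0).ncard : ℤ) - ((M.quotientCells Γ 1).ncard : ℤ) +
    ((M.quotientCells Γ 2).ncard : ℤ)

/-- `S` is a complete set of pairwise `Γ`-inequivalent vertices. -/
def IsVertexTransversal (M : EmbeddedPolyhedron) (Γ : Submodule ℤ Space3)
    (S : Set Space3) : Prop :=
  S ⊆ M.vertices ∧ ∀ v ∈ M.vertices, ∃! p, p ∈ S ∧ v - p ∈ Γ

end EmbeddedPolyhedron

/-- The Dirichlet domain of `Γ` centred at the origin. -/
def dirichletDomain (Γ : Submodule ℤ Space3) : Set Space3 :=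
  {x | ∀ γ ∈ Γ, dist x 0 ≤ dist x γ}

/-!
The idea is to count, modulo `Γ`, the pairs of a vertex `p` and a face `F ∋ p` that the leaf through
`p` crosses, that is, such that `ω` takes values on `F` both below and above its value at `p`.

Counted from the vertices, these pairs give the numbers `s` in the definition of the index: by
genericity no edge lies in a leaf, so every segment that the leaf cuts out of the star of `p` runs
through the interior of exactly one face, and every crossed face contributes exactly one segment
(`EmbeddedPolyhedron.ncard_cutSegments`).

Counted from the faces, a face with `n` vertices contributes `n - 2`: a generic linear function has
exactly one highest and one lowest point on it, both are vertices, and the leaves through all the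
other vertices cross the face (`EmbeddedPolyhedron.ncard_crossed_vertices`). A face has as many edges
as vertices, because each vertex is the head of exactly one edge when the boundary is oriented
counterclockwise (`card_edges_eq_card_vertices`); and every edge lies in exactly two faces
(`EmbeddedPolyhedron.ncard_facesOver_edge`). Hence `∑ s = ∑ (n - 2) = 2 E - 2 F`, and
`∑ (1 - s / 2) = V - E + F`. The counts are legitimate modulo `Γ` since translations act freely on
the cells (`IsFreeTransversal.sum_ncard_eq_sum_ncard`).

That an edge lies in exactly two faces is where the surface being a manifold enters. Near an
interior point `p` of the edge the surface is a book with the faces as pages. Were it a disc with no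
page, `p` would disconnect it; with one page, the complement of `p` would be contractible; with three
pages, there would be two functions on the complement of `p` with values in `ℂ \ {0}` which are
multiplicatively independent modulo exponentials. On a punctured plane, however, any two such
functions are dependent (`exists_zpow_mul_zpow_eq_exp`), by lifting through the covering map `exp`.

For the limit, group the vertices in a ball by their class modulo `Γ`, on which the index is
constant. As the translates of the Dirichlet domain tile the space, a class has asymptotically one
vertex in the ball per volume of this domain (`tendsto_ncard_norm_vadd_lt`).
-/

/-! ### Relative interiors of convex sets -/

section IntrinsicInterior

variable {E : Type*} [NormedAddCommGroup E] [NormedSpace ℝ E]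

/-- A point is in the relative interior of `C` exactly when `C` contains a neighbourhood of it in
its affine hull. -/
theorem mem_intrinsicInterior_iff_exists_ball {C : Set E} {x : E} :
    x ∈ intrinsicInterior ℝ C ↔
      x ∈ C ∧ ∃ ε > 0, ∀ v ∈ vectorSpan ℝ C, ‖v‖ < ε → x + v ∈ C := by
  rw [mem_intrinsicInterior]
  constructor
  · rintro ⟨y, hy, rfl⟩
    refine ⟨(interior_subset hy : _ ∈ (Subtype.val ⁻¹' C : Set (affineSpan ℝ C))), ?_⟩
    rw [mem_interior_iff_mem_nhds, Metric.mem_nhds_iff] at hy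
    obtain ⟨ε, hε, h⟩ := hy
    refine ⟨ε, hε, fun v hv hvε => ?_⟩
    have hm : (y : E) + v ∈ affineSpan ℝ C := by
      rw [add_comm]
      exact AffineSubspace.vadd_mem_of_mem_direction (by rwa [direction_affineSpan]) y.2
    have : (⟨(y : E) + v, hm⟩ : affineSpan ℝ C) ∈ Metric.ball y ε := by
      rw [Metric.mem_ball, Subtype.dist_eq]
      simpa using hvε
    exact h this
  · rintro ⟨hx, ε, hε, h⟩
    refine ⟨⟨x, subset_affineSpan ℝ C hx⟩, ?_, rfl⟩
    rw [mem_interior_iff_mem_nhds, Metric.mem_nhds_iff]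
    refine ⟨ε, hε, fun z hz => ?_⟩
    rw [Metric.mem_ball, Subtype.dist_eq, dist_eq_norm] at hz
    have hv : (z : E) - x ∈ vectorSpan ℝ C := by
      rw [← direction_affineSpan]
      exact AffineSubspace.vsub_mem_direction z.2 (subset_affineSpan ℝ C hx)
    have := h _ hv hz
    simpa using this

theorem intrinsicFrontier_eq_sdiff {C : Set E} (hC : IsClosed C) :
    intrinsicFrontier ℝ C = C \ intrinsicInterior ℝ C := by
  rw [← intrinsicClosure_sdiff_intrinsicInterior,
    IsClosed.intrinsicClosure (hC.preimage continuous_subtype_val)]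

theorem Convex.add_smul_mem_intrinsicInterior {C : Set E} (hC : Convex ℝ C) {x y : E}
    (hx : x ∈ intrinsicInterior ℝ C) (hy : y ∈ C) {t : ℝ} (ht0 : 0 ≤ t) (ht1 : t < 1) :
    x + t • (y - x) ∈ intrinsicInterior ℝ C := by
  rw [mem_intrinsicInterior_iff_exists_ball] at hx ⊢
  obtain ⟨hx, ε, hε, h⟩ := hx
  have h1 : (0 : ℝ) < 1 - t := by linarith
  refine ⟨hC.add_smul_sub_mem hx hy ⟨ht0, ht1.le⟩, (1 - t) * ε, by positivity, fun v hv hvε => ?_⟩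
  have h2 : x + (1 - t)⁻¹ • v ∈ C := by
    refine h _ (Submodule.smul_mem _ _ hv) ?_
    rw [norm_smul, norm_inv, Real.norm_of_nonneg h1.le, inv_mul_lt_iff₀ h1]
    exact hvε
  have h3 := hC.add_smul_sub_mem h2 hy ⟨ht0, ht1.le⟩
  convert h3 using 1
  have : v = (1 - t) • ((1 - t)⁻¹ • v) := by rw [smul_inv_smul₀ h1.ne']
  conv_lhs => rw [this]
  module

/-- A segment ending at a relatively interior point can be prolonged beyond it. -/
theorem exists_add_smul_sub_mem_of_mem_intrinsicInterior {C : Set E} {x y : E}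
    (hx : x ∈ intrinsicInterior ℝ C) (hy : y ∈ C) : ∃ t > (0 : ℝ), x + t • (x - y) ∈ C := by
  rw [mem_intrinsicInterior_iff_exists_ball] at hx
  obtain ⟨hx, ε, hε, h⟩ := hx
  have hpos : 0 < ‖x - y‖ + 1 := by positivity
  refine ⟨ε / (‖x - y‖ + 1), by positivity, h _ (Submodule.smul_mem _ _
    (vsub_mem_vectorSpan ℝ hx hy)) ?_⟩
  rw [norm_smul, Real.norm_of_nonneg (by positivity), div_mul_eq_mul_div, div_lt_iff₀ hpos]
  nlinarith

/-- A linear function that attains its maximum over `C` at a relatively interior point is constant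
on `C`. -/
theorem eq_of_isMaxOn_intrinsicInterior {C : Set E} (f : E →ₗ[ℝ] ℝ) {x : E}
    (hx : x ∈ intrinsicInterior ℝ C) (hmax : ∀ y ∈ C, f y ≤ f x) : ∀ y ∈ C, f y = f x := by
  intro y hy
  obtain ⟨t, ht, h⟩ := exists_add_smul_sub_mem_of_mem_intrinsicInterior hx hy
  have h1 := hmax _ h
  simp only [map_add, map_smul, map_sub, smul_eq_mul] at h1
  have h2 := hmax _ hy
  nlinarith

theorem intrinsicInterior_segment [FiniteDimensional ℝ E] {a b : E} (hab : a ≠ b) :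
    intrinsicInterior ℝ (segment ℝ a b) = openSegment ℝ a b := by
  have key : ∀ a b : E, a ≠ b → a ∉ intrinsicInterior ℝ (segment ℝ a b) := by
    intro a b hab ha
    obtain ⟨t, ht, h⟩ :=
      exists_add_smul_sub_mem_of_mem_intrinsicInterior ha (right_mem_segment ℝ a b)
    rw [segment_eq_image'] at h
    obtain ⟨s, ⟨hs, -⟩, h⟩ := h
    have : (s + t) • (b - a) = 0 := by
      have h' : a + s • (b - a) - (a + t • (a - b)) = 0 := by rw [sub_eq_zero]; exact h
      rw [← h']; module
    rcases smul_eq_zero.1 this with h0 | h0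
    · linarith
    · exact hab (sub_eq_zero.1 h0).symm
  apply Set.Subset.antisymm
  · intro x hx
    have hx' := intrinsicInterior_subset hx
    rcases eq_or_ne x a with rfl | ha
    · exact absurd hx (key _ _ hab)
    rcases eq_or_ne x b with rfl | hb
    · rw [segment_symm] at hx
      exact absurd hx (key _ _ hab.symm)
    · exact mem_openSegment_of_ne_left_right ha.symm hb.symm hx'
  · intro x hx
    obtain ⟨z, hz⟩ := (intrinsicInterior_nonempty (convex_segment (𝕜 := ℝ) a b)).2
      ⟨a, left_mem_segment ℝ a b⟩
    have hzs := intrinsicInterior_subset hz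
    have hxs := openSegment_subset_segment ℝ a b hx
    rw [segment_eq_image'] at hzs
    obtain ⟨s, ⟨hs0, hs1⟩, rfl⟩ := hzs
    rw [openSegment_eq_image'] at hx
    obtain ⟨t, ⟨ht0, ht1⟩, rfl⟩ := hx
    simp only at hz ⊢
    have hs0' : 0 < s := by
      refine lt_of_le_of_ne hs0 ?_
      rintro rfl
      exact key a b hab (by simpa using hz)
    have hs1' : s < 1 := by
      refine lt_of_le_of_ne hs1 ?_
      rintro rfl
      have : b ∉ intrinsicInterior ℝ (segment ℝ a b) := by
        rw [segment_symm]; exact key b a hab.symm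
      exact this (by simpa using hz)
    rcases le_or_gt t s with h | h
    · have := (convex_segment (𝕜 := ℝ) a b).add_smul_mem_intrinsicInterior hz
        (left_mem_segment ℝ a b) (t := (s - t) / s) (div_nonneg (by linarith) hs0)
        (by rw [div_lt_one hs0']; linarith)
      convert this using 1
      have h4 : (s - t) / s * s = s - t := by field_simp
      generalize (s - t) / s = r at h4
      obtain rfl : t = s - r * s := by linarith
      module
    · have := (convex_segment (𝕜 := ℝ) a b).add_smul_mem_intrinsicInterior hz
        (right_mem_segment ℝ a b) (t := (t - s) / (1 - s)) (div_nonneg (by linarith) (by linarith))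
        (by rw [div_lt_one (by linarith)]; linarith)
      convert this using 1
      have h4 : (t - s) / (1 - s) * (1 - s) = t - s := div_mul_cancel₀ _ (by linarith)
      generalize (t - s) / (1 - s) = r at h4
      obtain rfl : t = s + r * (1 - s) := by linarith
      module

end IntrinsicInterior

/-! ### Incidence of cells -/

theorem cellDim_mono {C D : Set Space3} (h : C ⊆ D) : cellDim C ≤ cellDim D :=
  Submodule.finrank_mono (vectorSpan_mono ℝ h)

theorem cellDim_singleton (p : Space3) : cellDim {p} = 0 := by
  simp [cellDim]

theorem subsingleton_of_cellDim_eq_zero {C : Set Space3} (h : cellDim C = 0) :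
    C.Subsingleton := by
  intro x hx y hy
  have h1 : x - y ∈ vectorSpan ℝ C := vsub_mem_vectorSpan ℝ hx hy
  rw [Submodule.finrank_eq_zero.1 h, Submodule.mem_bot] at h1
  exact sub_eq_zero.1 h1

namespace EmbeddedPolyhedron

variable {M : EmbeddedPolyhedron} {C D : Set Space3} {x p : Space3}

theorem isCompact_cell (hC : C ∈ M.cells) : IsCompact C := by
  obtain ⟨⟨s, hs, -, rfl⟩, -⟩ := M.isConvexCell C hC
  exact hs.isCompact_convexHull ℝ

theorem isClosed_cell (hC : C ∈ M.cells) : IsClosed C := (isCompact_cell hC).isClosed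

theorem convex_cell (hC : C ∈ M.cells) : Convex ℝ C := by
  obtain ⟨⟨s, hs, -, rfl⟩, -⟩ := M.isConvexCell C hC
  exact convex_convexHull ℝ s

theorem nonempty_cell (hC : C ∈ M.cells) : C.Nonempty := by
  obtain ⟨⟨s, hs, hne, rfl⟩, -⟩ := M.isConvexCell C hC
  exact hne.convexHull

theorem cellDim_le_two (hC : C ∈ M.cells) : cellDim C ≤ 2 := (M.isConvexCell C hC).2

theorem intrinsicInterior_cell_nonempty (hC : C ∈ M.cells) :
    (intrinsicInterior ℝ C).Nonempty :=
  (intrinsicInterior_nonempty (convex_cell hC)).2 (nonempty_cell hC)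

theorem eq_of_mem_intrinsicInterior (hC : C ∈ M.cells) (hD : D ∈ M.cells)
    (hxC : x ∈ intrinsicInterior ℝ C) (hxD : x ∈ intrinsicInterior ℝ D) : C = D := by
  by_contra h
  exact Set.disjoint_left.1 (M.disjoint_interior C hC D hD h) hxC hxD

/-- A cell is the union of its relative interior and of lower-dimensional cells. -/
theorem mem_intrinsicInterior_or_exists (hC : C ∈ M.cells) (hx : x ∈ C) :
    x ∈ intrinsicInterior ℝ C ∨
      ∃ D ∈ M.cells, D ⊆ intrinsicFrontier ℝ C ∧ cellDim D < cellDim C ∧ x ∈ D := by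
  by_cases h : x ∈ intrinsicInterior ℝ C
  · exact .inl h
  · right
    have hx' : x ∈ intrinsicFrontier ℝ C := by
      rw [intrinsicFrontier_eq_sdiff (isClosed_cell hC)]
      exact ⟨hx, h⟩
    obtain ⟨T, hT, hdim, hU⟩ := M.boundary_eq C hC
    rw [hU] at hx'
    obtain ⟨D, hD, hxD⟩ := hx'
    exact ⟨D, hT hD, hU ▸ Set.subset_sUnion_of_mem hD, hdim D hD, hxD⟩

/-- Every point of a cell is in the relative interior of one of its subcells. -/
theorem exists_mem_intrinsicInterior (hC : C ∈ M.cells) (hx : x ∈ C) :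
    ∃ D ∈ M.cells, D ⊆ C ∧ x ∈ intrinsicInterior ℝ D := by
  induction h : cellDim C using Nat.strong_induction_on generalizing C with
  | _ n ih =>
    subst h
    rcases mem_intrinsicInterior_or_exists hC hx with h | ⟨D, hD, hDC, hlt, hxD⟩
    · exact ⟨C, hC, subset_rfl, h⟩
    · obtain ⟨D', hD', hDD', hx'⟩ := ih _ hlt hD hxD rfl
      exact ⟨D', hD', hDD'.trans (hDC.trans (intrinsicFrontier_subset (isClosed_cell hC))), hx'⟩

/-- A cell that meets the relative interior of another cell contains it. -/
theorem subset_of_mem_intrinsicInterior (hC : C ∈ M.cells) (hD : D ∈ M.cells) (hxC : x ∈ C)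
    (hxD : x ∈ intrinsicInterior ℝ D) : D ⊆ C := by
  obtain ⟨D', hD', hDC, hx'⟩ := exists_mem_intrinsicInterior hC hxC
  rwa [eq_of_mem_intrinsicInterior hD hD' hxD hx']

theorem cellDim_lt_of_ssubset (hC : C ∈ M.cells) (hD : D ∈ M.cells) (hDC : D ⊆ C) (hne : D ≠ C) :
    cellDim D < cellDim C := by
  obtain ⟨x, hx⟩ := intrinsicInterior_cell_nonempty hD
  rcases mem_intrinsicInterior_or_exists hC (hDC (intrinsicInterior_subset hx)) with
    h | ⟨D', hD', -, hlt, hxD⟩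
  · exact absurd (eq_of_mem_intrinsicInterior hD hC hx h) hne
  · exact (cellDim_mono (subset_of_mem_intrinsicInterior hD' hD hxD hx)).trans_lt hlt

theorem eq_of_subset_of_cellDim_le (hC : C ∈ M.cells) (hD : D ∈ M.cells) (hDC : D ⊆ C)
    (h : cellDim C ≤ cellDim D) : D = C := by
  by_contra hne
  exact (cellDim_lt_of_ssubset hC hD hDC hne).not_ge h

theorem exists_eq_singleton (hC : C ∈ M.cells) (h : cellDim C = 0) :
    ∃ p ∈ M.vertices, C = {p} := by
  obtain ⟨p, hp⟩ := nonempty_cell hC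
  have := (subsingleton_of_cellDim_eq_zero h).eq_singleton_of_mem hp
  exact ⟨p, by rw [vertices, Set.mem_ofPred_eq, ← this]; exact hC, this⟩

theorem notMem_intrinsicInterior_of_vertex (hC : C ∈ M.cells) (h : cellDim C ≠ 0)
    (hp : p ∈ M.vertices) : p ∉ intrinsicInterior ℝ C := by
  intro h'
  apply h
  rw [← eq_of_mem_intrinsicInterior hp hC (by simp) h', cellDim_singleton]

/-- Only finitely many cells meet a given compact set. -/
theorem finite_cells_meeting {k : Set Space3} (hk : IsCompact k) :
    {C ∈ M.cells | (C ∩ k).Nonempty}.Finite := by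
  choose U hU hfin using M.locallyFinite
  obtain ⟨t, -, ht⟩ := hk.elim_nhds_subcover U (fun x _ => hU x)
  refine (t.finite_toSet.biUnion fun x _ => hfin x).subset ?_
  rintro C ⟨hC, y, hyC, hyk⟩
  obtain ⟨x, hx, hyx⟩ := Set.mem_iUnion₂.1 (ht hyk)
  exact Set.mem_iUnion₂.2 ⟨x, hx, hC, y, hyC, hyx⟩

theorem finite_subcells (hC : C ∈ M.cells) : {D ∈ M.cells | D ⊆ C}.Finite := by
  refine (finite_cells_meeting (M := M) (isCompact_cell hC)).subset ?_
  rintro D ⟨hD, hDC⟩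
  obtain ⟨y, hy⟩ := nonempty_cell hD
  exact ⟨hD, y, hy, hDC hy⟩

theorem finite_cells_containing (p : Space3) : {D ∈ M.cells | p ∈ D}.Finite := by
  refine (finite_cells_meeting (M := M) (isCompact_singleton (x := p))).subset ?_
  rintro D ⟨hD, hp⟩
  exact ⟨hD, p, hp, rfl⟩

theorem exists_eq_segment_of_cellDim_eq_one (hC : C ∈ M.cells) (h : cellDim C = 1) :
    ∃ a b : Space3, a ≠ b ∧ C = segment ℝ a b := by
  obtain ⟨x₀, hx₀⟩ := nonempty_cell hC
  obtain ⟨⟨d, hd⟩, hd0, hspan⟩ := finrank_eq_one_iff'.1 h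
  have hd0' : d ≠ 0 := fun h => hd0 (Subtype.ext h)
  have hpar : ∀ x ∈ C, ∃ t : ℝ, x = x₀ + t • d := by
    intro x hx
    obtain ⟨c, hc⟩ := hspan ⟨x - x₀, vsub_mem_vectorSpan ℝ hx hx₀⟩
    refine ⟨c, ?_⟩
    have : c • d = x - x₀ := congrArg Subtype.val hc
    rw [this]; abel
  let ℓ : ℝ →ᵃ[ℝ] Space3 := AffineMap.lineMap x₀ (x₀ + d)
  have hℓ : ∀ t, ℓ t = x₀ + t • d := by
    intro t; simp [ℓ, AffineMap.lineMap_apply, add_comm]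
  have hℓcont : Continuous ℓ := AffineMap.lineMap_continuous
  have hT : C = ℓ '' (ℓ ⁻¹' C) := by
    refine (Set.image_preimage_eq_iff.2 ?_).symm
    intro x hx
    obtain ⟨t, rfl⟩ := hpar x hx
    exact ⟨t, hℓ t⟩
  have hconv : Convex ℝ (ℓ ⁻¹' C) := (convex_cell hC).affine_preimage ℓ
  have hclosed : IsClosed (ℓ ⁻¹' C) := (isClosed_cell hC).preimage hℓcont
  have hbdd : Bornology.IsBounded (ℓ ⁻¹' C) := by
    obtain ⟨R, hR⟩ := (isCompact_cell hC).isBounded.subset_closedBall x₀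
    refine (Metric.isBounded_closedBall (x := (0 : ℝ)) (r := R / ‖d‖)).subset fun t ht => ?_
    have h1 := hR ht
    rw [hℓ, Metric.mem_closedBall, dist_eq_norm, add_sub_cancel_left, norm_smul] at h1
    rw [mem_closedBall_zero_iff, le_div_iff₀ (norm_pos_iff.2 hd0')]
    exact h1
  have hne : (ℓ ⁻¹' C).Nonempty := ⟨0, by simpa [hℓ] using hx₀⟩
  have hIcc := eq_Icc_of_connected_compact ⟨hne, hconv.isPreconnected⟩
    (Metric.isCompact_of_isClosed_isBounded hclosed hbdd)
  set u := sInf (ℓ ⁻¹' C)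
  set v := sSup (ℓ ⁻¹' C)
  have huv : u ≤ v := by rw [hIcc] at hne; exact Set.nonempty_Icc.1 hne
  have hseg : C = segment ℝ (ℓ u) (ℓ v) := by
    rw [hT, hIcc, ← segment_eq_Icc huv, image_segment]
  refine ⟨ℓ u, ℓ v, ?_, hseg⟩
  intro heq
  rw [← heq, segment_same] at hseg
  rw [hseg, cellDim_singleton] at h
  exact zero_ne_one h

/-- The two endpoints of an edge are vertices, since the relative boundary of the edge is a union
of cells of degree zero. -/
theorem exists_edge_endpoints (hC : C ∈ M.cells) (h : cellDim C = 1) :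
    ∃ a b : Space3, a ≠ b ∧ C = segment ℝ a b ∧ intrinsicInterior ℝ C = openSegment ℝ a b ∧
      a ∈ M.vertices ∧ b ∈ M.vertices := by
  obtain ⟨a, b, hab, rfl⟩ := exists_eq_segment_of_cellDim_eq_one hC h
  have hint := intrinsicInterior_segment (E := Space3) hab
  have key : ∀ x ∈ segment ℝ a b, x ∉ openSegment ℝ a b → x ∈ M.vertices := by
    intro x hx hxo
    rcases mem_intrinsicInterior_or_exists hC hx with h' | ⟨D, hD, -, hlt, hxD⟩
    · exact absurd (hint ▸ h') hxo
    · obtain ⟨p, hp, rfl⟩ := exists_eq_singleton hD (by omega)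
      rwa [Set.mem_singleton_iff.1 hxD]
  refine ⟨a, b, hab, rfl, hint, key a (left_mem_segment ℝ a b) ?_,
    key b (right_mem_segment ℝ a b) ?_⟩
  · rw [left_mem_openSegment_iff]; exact hab
  · rw [right_mem_openSegment_iff]; exact hab

end EmbeddedPolyhedron

/-! ### Continuous logarithms on the punctured plane -/

section PuncturedPlane

open Complex

theorem sub_eq_sub_of_exp_eq_exp {Y : Type*} [TopologicalSpace Y] {S : Set Y}
    (hS : IsPreconnected S) {G H : Y → ℂ} (hG : ContinuousOn G S) (hH : ContinuousOn H S)
    (h : ∀ y ∈ S, exp (G y) = exp (H y)) {x y : Y} (hx : x ∈ S) (hy : y ∈ S) :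
    G x - H x = G y - H y := by
  have key := isCoveringMap_exp.constOn_of_comp hS (hG.sub hH) (fun a ha b hb => ?_) hx hy
  · exact key
  · have : ∀ a ∈ S, exp (G a - H a) = 1 := by
      intro a ha
      rw [exp_sub, h a ha, div_self (exp_ne_zero _)]
    exact Subtype.ext ((this a ha).trans (this b hb).symm)

/-- On a simply connected space every nowhere vanishing function has a continuous logarithm. -/
theorem exists_continuous_log {Y : Type*} [TopologicalSpace Y] [SimplyConnectedSpace Y]
    [LocallyPathConnectedSpace Y] {f : Y → ℂ} (hf : Continuous f) (h0 : ∀ y, f y ≠ 0) :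
    ∃ L : Y → ℂ, Continuous L ∧ ∀ y, exp (L y) = f y := by
  obtain ⟨y₀⟩ : Nonempty Y := inferInstance
  let f' : C(Y, {z : ℂ // z ≠ 0}) := ⟨fun y => ⟨f y, h0 y⟩, by fun_prop⟩
  obtain ⟨L, ⟨-, hL⟩, -⟩ := isCoveringMap_exp.existsUnique_continuousMap_lifts f' y₀ (log (f y₀))
    (Subtype.ext (exp_log (h0 y₀)))
  exact ⟨L, L.continuous, fun y => congrArg Subtype.val (congrFun hL y)⟩

theorem not_simplyConnectedSpace_punctured : ¬ SimplyConnectedSpace {z : ℂ // z ≠ 0} := by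
  intro h
  have : LocallyPathConnectedSpace {z : ℂ // z ≠ 0} :=
    IsOpen.locallyPathConnectedSpace (isOpen_ne (x := (0 : ℂ)))
  obtain ⟨L, hL, hexp⟩ := exists_continuous_log (f := fun z : {z : ℂ // z ≠ 0} => (z : ℂ))
    continuous_subtype_val (fun z => z.2)
  have h1 := sub_eq_sub_of_exp_eq_exp (S := Set.univ) (isPreconnected_univ (α := ℂ))
    (G := fun w => L ⟨exp w, exp_ne_zero w⟩) (H := fun w => w) (by fun_prop) (by fun_prop)
    (fun w _ => hexp _) (Set.mem_univ 0) (Set.mem_univ (2 * Real.pi * I))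
  have h2 : (⟨exp (2 * Real.pi * I), exp_ne_zero _⟩ : {z : ℂ // z ≠ 0}) =
      ⟨exp 0, exp_ne_zero _⟩ := by
    ext1
    simp
  simp only [h2] at h1
  have h3 : (2 * Real.pi * I : ℂ) = 0 := by linear_combination h1
  exact two_pi_I_ne_zero h3

/-- Up to an exponential, every nowhere vanishing function on the punctured plane is a power of
the coordinate. -/
theorem exists_eq_zpow_mul_exp {f : {z : ℂ // z ≠ 0} → ℂ} (hf : Continuous f)
    (h0 : ∀ z, f z ≠ 0) :
    ∃ (n : ℤ) (g : {z : ℂ // z ≠ 0} → ℂ), Continuous g ∧ ∀ z, f z = (z : ℂ) ^ n * exp (g z) := by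
  let e : ℂ → {z : ℂ // z ≠ 0} := fun w => ⟨exp w, exp_ne_zero w⟩
  have he : Continuous e := by fun_prop
  have hsurj : Function.Surjective e := fun z => ⟨log z, Subtype.ext (exp_log z.2)⟩
  have hquot : IsQuotientMap e := isCoveringMap_exp.isQuotientMap hsurj
  obtain ⟨L, hL, hexp⟩ := exists_continuous_log (hf.comp he) (fun w => h0 _)
  have hper : ∀ w, e (w + 2 * Real.pi * I) = e w := fun w => Subtype.ext (exp_periodic w)
  have h1 : ∀ w, L (w + 2 * Real.pi * I) - L w = L (0 + 2 * Real.pi * I) - L 0 := by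
    intro w
    refine sub_eq_sub_of_exp_eq_exp (S := Set.univ) (isPreconnected_univ (α := ℂ))
      (G := fun w => L (w + 2 * Real.pi * I)) (H := L) (by fun_prop) (by fun_prop)
      (fun w _ => ?_) (Set.mem_univ w) (Set.mem_univ 0)
    simp only [hexp, Function.comp, hper]
  -- `n` is the winding number of `f` around the origin
  obtain ⟨n, hn⟩ : ∃ n : ℤ, L (0 + 2 * Real.pi * I) = L 0 + n * (2 * Real.pi * I) := by
    rw [← exp_eq_exp_iff_exists_int, hexp, hexp]
    simp only [Function.comp, hper]
  let G : ℂ → ℂ := fun w => L w - n * w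
  have hG : Function.Periodic G (2 * Real.pi * I) := by
    intro w
    have := h1 w
    simp only [G]
    linear_combination this + hn
  let g : {z : ℂ // z ≠ 0} → ℂ := fun z => G (log z)
  have hge : g ∘ e = G := by
    funext w
    obtain ⟨k, hk⟩ := exp_eq_exp_iff_exists_int.1 (exp_log (exp_ne_zero w))
    simp only [Function.comp, g, e, hk]
    exact hG.int_mul k w
  refine ⟨n, g, hquot.continuous_iff.2 ?_, fun z => ?_⟩
  · rw [hge]
    fun_prop
  · obtain ⟨w, rfl⟩ := hsurj z
    have h2 : g (e w) = G w := congrFun hge w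
    have h3 : exp (L w) = f (e w) := hexp w
    rw [h2, ← h3]
    simp only [e, G]
    rw [← exp_int_mul, ← exp_add]
    congr 1
    ring

/-- Any two nowhere vanishing functions on a punctured plane are multiplicatively dependent
modulo exponentials: the first integral cohomology of the punctured plane has rank one. -/
theorem exists_zpow_mul_zpow_eq_exp {Y : Type*} [TopologicalSpace Y]
    (φ : Y ≃ₜ {z : ℂ // z ≠ 0}) {f g : Y → ℂ} (hf : Continuous f) (hg : Continuous g)
    (hf0 : ∀ y, f y ≠ 0) (hg0 : ∀ y, g y ≠ 0) :
    ∃ m n : ℤ, (m ≠ 0 ∨ n ≠ 0) ∧ ∃ H : Y → ℂ, Continuous H ∧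
      ∀ y, f y ^ m * g y ^ n = exp (H y) := by
  obtain ⟨k, F, hF, hFe⟩ := exists_eq_zpow_mul_exp (hf.comp φ.symm.continuous) (fun z => hf0 _)
  obtain ⟨l, G, hG, hGe⟩ := exists_eq_zpow_mul_exp (hg.comp φ.symm.continuous) (fun z => hg0 _)
  have hf' : ∀ y, f y = (φ y : ℂ) ^ k * exp (F (φ y)) := fun y => by simpa using hFe (φ y)
  have hg' : ∀ y, g y = (φ y : ℂ) ^ l * exp (G (φ y)) := fun y => by simpa using hGe (φ y)
  by_cases hk : k = 0
  · refine ⟨1, 0, .inl one_ne_zero, fun y => F (φ y), by fun_prop, fun y => ?_⟩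
    rw [hf' y, hk]
    simp
  · refine ⟨l, -k, .inr (neg_ne_zero.2 hk), fun y => l * F (φ y) - k * G (φ y), by fun_prop,
      fun y => ?_⟩
    have h0 : (φ y : ℂ) ≠ 0 := (φ y).2
    rw [hf' y, hg' y, exp_sub, exp_int_mul, exp_int_mul, mul_zpow, mul_zpow, ← zpow_mul,
      ← zpow_mul, mul_neg, zpow_neg, zpow_neg, mul_comm l k]
    field_simp

/-- A function with values in a closed half-plane has a logarithm, whose increment between a
negative and a positive value is `∓π`. -/
theorem exists_log_of_im_nonneg {Y : Type*} [TopologicalSpace Y] {S : Set Y} {f : Y → ℂ}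
    (hf : ContinuousOn f S) (h0 : ∀ y ∈ S, f y ≠ 0) {ε : ℤ} (hε : ε = 1 ∨ ε = -1)
    (him : ∀ y ∈ S, 0 ≤ ε * (f y).im) {x y : Y} {a : ℝ} (ha : 0 < a)
    (hx : f x = a) (hy : f y = -a) :
    ∃ L : Y → ℂ, ContinuousOn L S ∧ (∀ y ∈ S, exp (L y) = f y) ∧ L x - L y = -(Real.pi * I) * ε := by
  have hε2 : (ε : ℂ) * ε = 1 := by rcases hε with rfl | rfl <;> norm_num
  have hε2' : (ε : ℝ) * ε = 1 := by rcases hε with rfl | rfl <;> norm_num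
  refine ⟨fun y => log (-I * ε * f y) + ε * (Real.pi / 2 * I), ?_, fun y hy => ?_, ?_⟩
  · refine ContinuousOn.add (ContinuousOn.clog (by fun_prop) fun y hy => ?_) (by fun_prop)
    have hre : (-I * ε * f y).re = ε * (f y).im := by simp
    have himg : (-I * ε * f y).im = -(ε * (f y).re) := by simp
    rw [mem_slitPlane_iff, hre, himg]
    by_contra hcon
    push Not at hcon
    obtain ⟨h1, h2⟩ := hcon
    have h1' := le_antisymm h1 (him y hy)
    apply h0 y hy
    have hε0 : (ε : ℝ) ≠ 0 := by intro h; rw [h] at hε2'; norm_num at hε2'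
    apply Complex.ext
    · simpa [hε0] using h2
    · simpa [hε0] using h1'
  · have hne : -I * ε * f y ≠ 0 := by
      refine mul_ne_zero (mul_ne_zero (neg_ne_zero.2 I_ne_zero) ?_) (h0 y hy)
      intro h; rw [h] at hε2; norm_num at hε2
    have : exp (ε * (Real.pi / 2 * I)) = ε * I := by
      rcases hε with rfl | rfl
      · simp
      · simp [exp_neg]
    rw [exp_add, exp_log hne, this]
    linear_combination (-I * I * f y) * hε2 - f y * I_mul_I
  · have h1 : -I * ε * f x = a * (-(ε : ℂ) * I) := by rw [hx]; ring
    have h2 : -I * ε * f y = a * ((ε : ℂ) * I) := by rw [hy]; ring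
    have hI : (ε : ℂ) * I ≠ 0 := by rcases hε with rfl | rfl <;> simp
    have hI' : -(ε : ℂ) * I ≠ 0 := by rcases hε with rfl | rfl <;> simp
    simp only [h1, h2]
    rw [log_ofReal_mul ha hI, log_ofReal_mul ha hI']
    rcases hε with rfl | rfl
    · simp [log_I, log_neg_I]; ring
    · simp [log_I, log_neg_I]; ring

/-- Three arcs joining the same two points cannot lie in a punctured plane as the pages of a book:
the functions `f` and `g`, which separate the first, respectively the second page from the other
two, would be multiplicatively independent modulo exponentials. -/
theorem false_of_three_pages {Y : Type*} [TopologicalSpace Y] (φ : Y ≃ₜ {z : ℂ // z ≠ 0})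
    {f g : Y → ℂ} (hf : Continuous f) (hg : Continuous g) (hf0 : ∀ y, f y ≠ 0)
    (hg0 : ∀ y, g y ≠ 0) {S₁ S₂ S₃ : Set Y} (hS₁ : IsPreconnected S₁) (hS₂ : IsPreconnected S₂)
    (hS₃ : IsPreconnected S₃) {x y : Y} (hx : x ∈ S₁ ∩ S₂ ∩ S₃) (hy : y ∈ S₁ ∩ S₂ ∩ S₃)
    (hf₁ : ∀ z ∈ S₁, 0 ≤ (f z).im) (hf₂ : ∀ z ∈ S₂, (f z).im ≤ 0)
    (hf₃ : ∀ z ∈ S₃, (f z).im ≤ 0) (hg₁ : ∀ z ∈ S₁, (g z).im ≤ 0)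
    (hg₂ : ∀ z ∈ S₂, 0 ≤ (g z).im) (hg₃ : ∀ z ∈ S₃, (g z).im ≤ 0)
    {a : ℝ} (ha : 0 < a) (hfx : f x = a) (hgx : g x = a) (hfy : f y = -a) (hgy : g y = -a) :
    False := by
  obtain ⟨m, n, hmn, H, hH, hHe⟩ := exists_zpow_mul_zpow_eq_exp φ hf hg hf0 hg0
  have key : ∀ (S : Set Y), IsPreconnected S → x ∈ S → y ∈ S → ∀ ε δ : ℤ, (ε = 1 ∨ ε = -1) →
      (δ = 1 ∨ δ = -1) → (∀ z ∈ S, 0 ≤ ε * (f z).im) → (∀ z ∈ S, 0 ≤ δ * (g z).im) →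
      H x - H y = -(Real.pi * I) * ((m * ε + n * δ : ℤ) : ℂ) := by
    intro S hS hxS hyS ε δ hε hδ h1 h2
    obtain ⟨L, hL, hLe, hLi⟩ := exists_log_of_im_nonneg (S := S) hf.continuousOn
      (fun z _ => hf0 z) hε h1 ha hfx hfy
    obtain ⟨K, hK, hKe, hKi⟩ := exists_log_of_im_nonneg (S := S) hg.continuousOn
      (fun z _ => hg0 z) hδ h2 ha hgx hgy
    have := sub_eq_sub_of_exp_eq_exp hS (G := H) (H := fun z => m * L z + n * K z)
      hH.continuousOn (by fun_prop) (fun z hz => ?_) hxS hyS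
    · push_cast
      linear_combination this + m * hLi + n * hKi
    · rw [← hHe, exp_add, exp_int_mul, exp_int_mul, hLe z hz, hKe z hz]
  have e₁ := key S₁ hS₁ hx.1.1 hy.1.1 1 (-1) (.inl rfl) (.inr rfl)
    (fun z hz => by simpa using hf₁ z hz) (fun z hz => by simpa using hg₁ z hz)
  have e₂ := key S₂ hS₂ hx.1.2 hy.1.2 (-1) 1 (.inr rfl) (.inl rfl)
    (fun z hz => by simpa using hf₂ z hz) (fun z hz => by simpa using hg₂ z hz)
  have e₃ := key S₃ hS₃ hx.2 hy.2 (-1) (-1) (.inr rfl) (.inr rfl)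
    (fun z hz => by simpa using hf₃ z hz) (fun z hz => by simpa using hg₃ z hz)
  have hpi : -(Real.pi * I : ℂ) ≠ 0 := by simp [Real.pi_ne_zero]
  have i₁ := mul_left_cancel₀ hpi (e₁.symm.trans e₂)
  have i₂ := mul_left_cancel₀ hpi (e₁.symm.trans e₃)
  have j₁ := Int.cast_injective (α := ℂ) i₁
  have j₂ := Int.cast_injective (α := ℂ) i₂
  omega

/-- The complement of a point in an open disc is a punctured plane. -/
theorem exists_homeomorph_punctured {X : Type*} [TopologicalSpace X]
    (h : X ≃ₜ Metric.ball (0 : EuclideanSpace ℝ (Fin 2)) 1) (p : X) :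
    Nonempty ({x : X // x ≠ p} ≃ₜ {z : ℂ // z ≠ 0}) := by
  let e : X ≃ₜ ℂ := (h.trans Homeomorph.unitBall.symm).trans
    orthonormalBasisOneI.repr.symm.toHomeomorph
  exact ⟨(e.trans (Homeomorph.subRight (e p))).subtype fun x => by simp [sub_eq_zero]⟩

end PuncturedPlane

/-! ### Every edge lies in exactly two faces -/

namespace EmbeddedPolyhedron

variable {M : EmbeddedPolyhedron} {C D e F : Set Space3} {x p : Space3}

/-- The faces containing the set `e`. -/
def facesOver (M : EmbeddedPolyhedron) (e : Set Space3) : Set (Set Space3) :=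
  {F ∈ M.cells | cellDim F = 2 ∧ e ⊆ F}

theorem facesOver_finite (he : e ∈ M.cells) : (M.facesOver e).Finite := by
  obtain ⟨p, hp⟩ := nonempty_cell he
  exact (finite_cells_containing p).subset fun F hF => ⟨hF.1, hF.2.2 hp⟩

theorem face_eq_of_mem_intrinsicInterior (hC : C ∈ M.cells) (hF : F ∈ M.cells) (h2 : cellDim F = 2)
    (hxC : x ∈ C) (hxF : x ∈ intrinsicInterior ℝ F) : F = C :=
  eq_of_subset_of_cellDim_le hC hF (subset_of_mem_intrinsicInterior hC hF hxC hxF)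
    (h2 ▸ cellDim_le_two hC)

/-- Around an interior point of an edge, the surface is a book: its spine is the edge and its pages
are the faces containing the edge. -/
theorem mem_openStar_of_edge (he : e ∈ M.cells) (h1 : cellDim e = 1)
    (hp : p ∈ intrinsicInterior ℝ e) :
    x ∈ openStar M.cells p ↔
      x ∈ intrinsicInterior ℝ e ∨ ∃ F ∈ M.facesOver e, x ∈ intrinsicInterior ℝ F := by
  simp only [openStar, Set.mem_iUnion, exists_prop]
  constructor
  · rintro ⟨C, ⟨hC, hpC⟩, hx⟩
    have heC := subset_of_mem_intrinsicInterior hC he hpC hp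
    rcases eq_or_ne e C with rfl | hne
    · exact .inl hx
    · have := cellDim_lt_of_ssubset hC he heC hne
      have := cellDim_le_two hC
      exact .inr ⟨C, ⟨hC, by omega, heC⟩, hx⟩
  · rintro (hx | ⟨F, hF, hx⟩)
    · exact ⟨e, ⟨he, intrinsicInterior_subset hp⟩, hx⟩
    · exact ⟨F, ⟨hF.1, hF.2.2 (intrinsicInterior_subset hp)⟩, hx⟩

/-- A page of the book, deprived of a point of the spine, is star-shaped. -/
theorem starConvex_page (he : e ∈ M.cells) (h1 : cellDim e = 1) (hp : p ∈ intrinsicInterior ℝ e)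
    (hF : F ∈ M.facesOver e) {o : Space3} (ho : o ∈ intrinsicInterior ℝ F) :
    StarConvex ℝ o ((intrinsicInterior ℝ e ∪ intrinsicInterior ℝ F) \ {p}) := by
  rw [starConvex_iff_segment_subset]
  intro y hy
  have hyF : y ∈ F := by
    rcases hy.1 with h | h
    · exact hF.2.2 (intrinsicInterior_subset h)
    · exact intrinsicInterior_subset h
  have hpF : p ∉ intrinsicInterior ℝ F := by
    intro h
    have := eq_of_mem_intrinsicInterior he hF.1 hp h
    have := hF.2.1
    simp_all
  rw [segment_eq_image']
  rintro _ ⟨t, ⟨ht0, ht1⟩, rfl⟩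
  rcases eq_or_lt_of_le ht1 with rfl | hlt
  · simpa using hy
  · have := (convex_cell hF.1).add_smul_mem_intrinsicInterior ho hyF ht0 hlt
    refine ⟨.inr this, fun h => hpF ?_⟩
    rw [← Set.mem_singleton_iff.1 h]
    exact this

theorem isPreconnected_page (he : e ∈ M.cells) (h1 : cellDim e = 1)
    (hp : p ∈ intrinsicInterior ℝ e) (hF : F ∈ M.facesOver e) (q : openStar M.cells p) (hq : q = p) :
    IsPreconnected {y : {y : openStar M.cells p // y ≠ q} |
      (y : Space3) ∈ intrinsicInterior ℝ e ∪ intrinsicInterior ℝ F} := by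
  have hind : IsInducing (fun y : {y : openStar M.cells p // y ≠ q} => (y : Space3)) :=
    IsInducing.subtypeVal.comp IsInducing.subtypeVal
  rw [← hind.isPreconnected_image]
  obtain ⟨o, ho⟩ := intrinsicInterior_cell_nonempty hF.1
  have hstar := starConvex_page he h1 hp hF ho
  convert! (hstar.isPathConnected ?_).isConnected.isPreconnected using 1
  · ext x
    constructor
    · rintro ⟨y, hy, rfl⟩
      exact ⟨hy, fun h => y.2 (Subtype.ext (h.trans hq.symm))⟩
    · rintro ⟨hx, hne⟩
      have hmem : x ∈ openStar M.cells p := by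
        rw [mem_openStar_of_edge he h1 hp]
        exact hx.imp id fun h => ⟨F, hF, h⟩
      exact ⟨⟨⟨x, hmem⟩, fun h => hne (by rw [← hq, ← h]; rfl)⟩, hx, rfl⟩
  · refine ⟨.inr ho, ?_⟩
    rintro rfl
    have := eq_of_mem_intrinsicInterior he hF.1 hp ho
    have := hF.2.1
    simp_all

/-- The distance from the other pages minus the distance from the page `J`: a function that is
nonnegative exactly on `J` within the book. It is meaningful if there are other pages: the distance
from the empty set is `0` by convention. -/
noncomputable def pageHeight (M : EmbeddedPolyhedron) (e J : Set Space3) (x : Space3) : ℝ :=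
  Metric.infDist x (⋃₀ (M.facesOver e \ {J})) - Metric.infDist x J

theorem continuous_pageHeight (e J : Set Space3) : Continuous (M.pageHeight e J) :=
  (Metric.continuous_infDist_pt _).sub (Metric.continuous_infDist_pt _)

theorem pageHeight_nonneg {J : Set Space3} (hx : x ∈ J) : 0 ≤ M.pageHeight e J x := by
  rw [pageHeight, Metric.infDist_zero_of_mem hx, sub_zero]
  exact Metric.infDist_nonneg

theorem pageHeight_nonpos {J : Set Space3} (hF : F ∈ M.facesOver e) (hFJ : F ≠ J) (hx : x ∈ F) :
    M.pageHeight e J x ≤ 0 := by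
  rw [pageHeight, Metric.infDist_zero_of_mem (s := ⋃₀ (M.facesOver e \ {J})) ⟨F, ⟨hF, hFJ⟩, hx⟩, zero_sub,
    neg_nonpos]
  exact Metric.infDist_nonneg

theorem pageHeight_ne_zero (he : e ∈ M.cells) {J F' : Set Space3} (hJ : J ∈ M.facesOver e)
    (hF' : F' ∈ M.facesOver e) (hne : F' ≠ J) (hF : F ∈ M.facesOver e)
    (hx : x ∈ intrinsicInterior ℝ F) : M.pageHeight e J x ≠ 0 := by
  intro h0
  have hxF := intrinsicInterior_subset hx
  by_cases hFJ : F = J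
  · subst hFJ
    rw [pageHeight, Metric.infDist_zero_of_mem hxF, sub_zero] at h0
    have hcl : IsClosed (⋃₀ (M.facesOver e \ {F})) := by
      rw [Set.sUnion_eq_biUnion]
      exact ((facesOver_finite he).subset Set.sdiff_subset).isClosed_biUnion
        fun t ht => isClosed_cell ht.1.1
    obtain ⟨y, hy⟩ := nonempty_cell hF'.1
    obtain ⟨G, hG, hxG⟩ := (hcl.mem_iff_infDist_zero ⟨y, F', ⟨hF', hne⟩, hy⟩).2 h0
    exact hG.2 (face_eq_of_mem_intrinsicInterior hG.1.1 hF.1 hF.2.1 hxG hx).symm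
  · rw [pageHeight, Metric.infDist_zero_of_mem (s := ⋃₀ (M.facesOver e \ {J}))
      ⟨F, ⟨hF, hFJ⟩, hxF⟩, zero_sub,
      neg_eq_zero] at h0
    have := ((isClosed_cell hJ.1).mem_iff_infDist_zero (nonempty_cell hJ.1)).2 h0
    exact hFJ (face_eq_of_mem_intrinsicInterior hJ.1 hF.1 hF.2.1 this hx)

/-- Since the surface is a topological disc around the midpoint of an edge, the book formed there
by the faces containing the edge has exactly two pages. -/
theorem ncard_facesOver_edge (he : e ∈ M.cells) (h1 : cellDim e = 1) :
    (M.facesOver e).ncard = 2 := by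
  obtain ⟨a, b, hab, hseg, hint, -, -⟩ := exists_edge_endpoints he h1
  set d := b - a with hd
  have hd0 : d ≠ 0 := sub_ne_zero.2 hab.symm
  set p := a + (1 / 2 : ℝ) • d with hpdef
  have hon : ∀ t : ℝ, 0 < t → t < 1 → a + t • d ∈ intrinsicInterior ℝ e := by
    intro t h0 h1
    rw [hint, openSegment_eq_image']
    exact ⟨t, ⟨h0, h1⟩, rfl⟩
  have hp : p ∈ intrinsicInterior ℝ e := hon _ (by norm_num) (by norm_num)
  have hpe := intrinsicInterior_subset hp
  have hmem : ∀ y ∈ intrinsicInterior ℝ e, y ∈ openStar M.cells p := fun y hy =>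
    (mem_openStar_of_edge he h1 hp).2 (.inl hy)
  -- `A` is a coordinate along the edge that vanishes at `p`
  let A : Space3 → ℝ := fun x => inner ℝ d (x - p)
  have hA : Continuous A := by fun_prop
  have hAt : ∀ t : ℝ, A (a + t • d) = (t - 1 / 2) * ‖d‖ ^ 2 := by
    intro t
    have : a + t • d - p = (t - 1 / 2) • d := by rw [hpdef]; module
    simp only [A, this, inner_smul_right, real_inner_self_eq_norm_sq]
  have hA0 : ∀ x ∈ intrinsicInterior ℝ e, A x = 0 → x = p := by
    intro x hx h0
    rw [hint, openSegment_eq_image'] at hx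
    obtain ⟨t, -, rfl⟩ := hx
    rw [hAt] at h0
    rcases mul_eq_zero.1 h0 with h | h
    · rw [hpdef, show t = 1 / 2 by linarith]
    · exact absurd (by simpa using h) hd0
  have hr : 0 < 1 / 4 * ‖d‖ ^ 2 := by positivity
  obtain ⟨hdisc⟩ := M.star_disc p ⟨e, he, hpe⟩
  let q : openStar M.cells p := ⟨p, hmem p hp⟩
  obtain ⟨φ⟩ := exists_homeomorph_punctured hdisc q
  -- two points of the spine, one on each side of `p`
  have hne : ∀ t : ℝ, t ≠ 1 / 2 → a + t • d ≠ p := by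
    intro t ht h
    apply ht
    have h2 : (t - 1 / 2) • d = 0 := by
      have : a + t • d - p = 0 := sub_eq_zero.2 h
      rw [← this, hpdef]; module
    rcases smul_eq_zero.1 h2 with h | h
    · linarith
    · exact absurd h hd0
  let pt : ∀ t : ℝ, 0 < t → t < 1 → t ≠ 1 / 2 → {y : openStar M.cells p // y ≠ q} :=
    fun t h0 h1 h2 => ⟨⟨a + t • d, hmem _ (hon t h0 h1)⟩, fun h => hne t h2 (congrArg Subtype.val h)⟩
  let x₁ := pt (3 / 4) (by norm_num) (by norm_num) (by norm_num)
  let x₂ := pt (1 / 4) (by norm_num) (by norm_num) (by norm_num)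
  have hx₁ : (x₁ : Space3) ∈ intrinsicInterior ℝ e := hon _ (by norm_num) (by norm_num)
  have hx₂ : (x₂ : Space3) ∈ intrinsicInterior ℝ e := hon _ (by norm_num) (by norm_num)
  have hAx₁ : A x₁ = 1 / 4 * ‖d‖ ^ 2 := by rw [← show (3 / 4 : ℝ) - 1 / 2 = 1 / 4 by norm_num]; exact hAt _
  have hAx₂ : A x₂ = -(1 / 4 * ‖d‖ ^ 2) := by
    rw [← neg_mul, ← show (1 / 4 : ℝ) - 1 / 2 = -(1 / 4) by norm_num]; exact hAt _
  have hfin := facesOver_finite he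
  rcases lt_trichotomy (M.facesOver e).ncard 2 with hlt | h | hgt
  · exfalso
    rcases Nat.lt_succ_iff_lt_or_eq.1 hlt with h0 | hone
    · -- without pages, the point `p` would disconnect its star
      have hempty : M.facesOver e = ∅ := (Set.ncard_eq_zero hfin).1 (by omega)
      have hpc : PreconnectedSpace {z : ℂ // z ≠ 0} := by
        refine Subtype.preconnectedSpace ?_
        exact (isConnected_compl_singleton_of_one_lt_rank (by simp) (0 : ℂ)).isPreconnected
      have : PreconnectedSpace {y : openStar M.cells p // y ≠ q} :=
        φ.symm.surjective.denseRange.preconnectedSpace φ.symm.continuous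
      obtain ⟨y, hy⟩ := mem_range_of_exists_le_of_exists_ge (c := (0 : ℝ))
        (f := fun y : {y : openStar M.cells p // y ≠ q} => A y) (by fun_prop)
        ⟨x₂, by rw [hAx₂]; linarith⟩ ⟨x₁, by rw [hAx₁]; linarith⟩
      have hye := (mem_openStar_of_edge he h1 hp).1 y.1.2
      rw [hempty] at hye
      simp only [Set.mem_empty_iff_false, false_and, exists_false, or_false] at hye
      exact y.2 (Subtype.ext (hA0 _ hye hy))
    · -- with one page, the star without `p` would be contractible
      obtain ⟨F, hF⟩ := Set.ncard_eq_one.1 hone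
      have hFm : F ∈ M.facesOver e := by rw [hF]; rfl
      obtain ⟨o, ho⟩ := intrinsicInterior_cell_nonempty hFm.1
      set T := (intrinsicInterior ℝ e ∪ intrinsicInterior ℝ F) \ {p} with hT
      have hTc : ContractibleSpace T :=
        (starConvex_page he h1 hp hFm ho).contractibleSpace ⟨x₁, .inl hx₁, fun h => x₁.2 (Subtype.ext h)⟩
      have hiff : ∀ x, x ∈ openStar M.cells p ↔
          x ∈ intrinsicInterior ℝ e ∪ intrinsicInterior ℝ F := by
        intro x
        rw [mem_openStar_of_edge he h1 hp, hF]
        simp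
      let ψ : T ≃ₜ {y : openStar M.cells p // y ≠ q} :=
        { toFun := fun y => ⟨⟨y, (hiff _).2 y.2.1⟩, fun h => y.2.2 (congrArg Subtype.val h)⟩
          invFun := fun y => ⟨y, (hiff _).1 y.1.2, fun h => y.2 (Subtype.ext h)⟩
          left_inv := fun y => rfl
          right_inv := fun y => rfl
          continuous_toFun := by fun_prop
          continuous_invFun := by fun_prop }
      exact not_simplyConnectedSpace_punctured
        (ContinuousMap.HomotopyEquiv.simplyConnectedSpace (ψ.trans φ).toHomotopyEquiv.symm)
  · exact h
  · exfalso
    obtain ⟨J₁, J₂, J₃, h₁, h₂, h₃, h₁₂, h₁₃, h₂₃⟩ := (Set.two_lt_ncard_iff hfin).1 hgt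
    -- `f J` maps the page `J` to the upper and all other pages to the lower half-plane
    let f : Set Space3 → {y : openStar M.cells p // y ≠ q} → ℂ :=
      fun J y => A y + M.pageHeight e J y * Complex.I
    have hf : ∀ J, Continuous (f J) := by
      intro J
      have := continuous_pageHeight (M := M) e J
      fun_prop
    have hre : ∀ J y, (f J y).re = A y := by intro J y; simp [f]
    have him : ∀ J y, (f J y).im = M.pageHeight e J y := by intro J y; simp [f]
    have hf0 : ∀ J ∈ M.facesOver e, (∃ F' ∈ M.facesOver e, F' ≠ J) → ∀ y, f J y ≠ 0 := by
      rintro J hJ ⟨F', hF', hne'⟩ y hy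
      have hy1 : A y = 0 := by rw [← hre J, hy]; rfl
      have hy2 : M.pageHeight e J y = 0 := by rw [← him J, hy]; rfl
      rcases (mem_openStar_of_edge he h1 hp).1 y.1.2 with h | ⟨F, hF, h⟩
      · exact y.2 (Subtype.ext (hA0 _ h hy1))
      · exact pageHeight_ne_zero he hJ hF' hne' hF h hy2
    have hsub : ∀ F ∈ M.facesOver e, ∀ y ∈ intrinsicInterior ℝ e ∪ intrinsicInterior ℝ F, y ∈ F := by
      rintro F hF y (hy | hy)
      · exact hF.2.2 (intrinsicInterior_subset hy)
      · exact intrinsicInterior_subset hy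
    have hpos : ∀ F ∈ M.facesOver e, ∀ y ∈ {y : {y : openStar M.cells p // y ≠ q} |
        (y : Space3) ∈ intrinsicInterior ℝ e ∪ intrinsicInterior ℝ F}, 0 ≤ (f F y).im := by
      intro F hF y hy
      rw [him]
      exact pageHeight_nonneg (hsub F hF _ hy)
    have hneg : ∀ F ∈ M.facesOver e, ∀ J, F ≠ J → ∀ y ∈ {y : {y : openStar M.cells p // y ≠ q} |
        (y : Space3) ∈ intrinsicInterior ℝ e ∪ intrinsicInterior ℝ F}, (f J y).im ≤ 0 := by
      intro F hF J hFJ y hy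
      rw [him]
      exact pageHeight_nonpos hF hFJ (hsub F hF _ hy)
    have hspine : ∀ J ∈ M.facesOver e, (∃ F' ∈ M.facesOver e, F' ≠ J) →
        ∀ y : {y : openStar M.cells p // y ≠ q}, (y : Space3) ∈ intrinsicInterior ℝ e →
          f J y = (A y : ℂ) := by
      rintro J hJ ⟨F', hF', hne'⟩ y hy
      apply Complex.ext
      · rw [hre]; rfl
      · exact le_antisymm (hneg F' hF' J hne' y (.inl hy)) (hpos J hJ y (.inl hy))
    refine false_of_three_pages φ (hf J₁) (hf J₂) (hf0 J₁ h₁ ⟨J₂, h₂, h₁₂.symm⟩)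
      (hf0 J₂ h₂ ⟨J₁, h₁, h₁₂⟩) (isPreconnected_page he h1 hp h₁ q rfl)
      (isPreconnected_page he h1 hp h₂ q rfl) (isPreconnected_page he h1 hp h₃ q rfl)
      (x := x₁) (y := x₂) ⟨⟨.inl hx₁, .inl hx₁⟩, .inl hx₁⟩ ⟨⟨.inl hx₂, .inl hx₂⟩, .inl hx₂⟩
      (hpos J₁ h₁) (hneg J₂ h₂ _ h₁₂.symm) (hneg J₃ h₃ _ h₁₃.symm) (hneg J₁ h₁ _ h₁₂)
      (hpos J₂ h₂) (hneg J₃ h₃ _ h₂₃.symm) hr ?_ ?_ ?_ ?_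
    · rw [hspine J₁ h₁ ⟨J₂, h₂, h₁₂.symm⟩ x₁ hx₁, hAx₁]
    · rw [hspine J₂ h₂ ⟨J₁, h₁, h₁₂⟩ x₁ hx₁, hAx₁]
    · rw [hspine J₁ h₁ ⟨J₂, h₂, h₁₂.symm⟩ x₂ hx₂, hAx₂, Complex.ofReal_neg]
    · rw [hspine J₂ h₂ ⟨J₁, h₁, h₁₂⟩ x₂ hx₂, hAx₂, Complex.ofReal_neg]

end EmbeddedPolyhedron

/-! ### The boundary of a plane polygon has as many edges as vertices -/

section Polygon

/-- The determinant of two vectors of the plane. -/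
def planeDet (u w : ℝ × ℝ) : ℝ := u.1 * w.2 - u.2 * w.1

theorem planeDet_smul_eq (u v w : ℝ × ℝ) :
    planeDet u v • w = planeDet w v • u + planeDet u w • v := by
  ext <;> simp [planeDet] <;> ring

theorem exists_eq_smul_of_planeDet_eq_zero {u w : ℝ × ℝ} (h : planeDet u w = 0) (hu : u ≠ 0) :
    ∃ c : ℝ, w = c • u := by
  have hu' : 0 < u.1 ^ 2 + u.2 ^ 2 := by
    by_contra hcon
    have h1 : u.1 = 0 := by nlinarith [sq_nonneg u.1, sq_nonneg u.2]
    have h2 : u.2 = 0 := by nlinarith [sq_nonneg u.1, sq_nonneg u.2]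
    exact hu (Prod.ext h1 h2)
  have h' : u.1 * w.2 = u.2 * w.1 := sub_eq_zero.1 h
  refine ⟨(u.1 * w.1 + u.2 * w.2) / (u.1 ^ 2 + u.2 ^ 2), ?_⟩
  ext
  · simp only [Prod.smul_fst, smul_eq_mul]
    field_simp
    linear_combination (-u.2) * h'
  · simp only [Prod.smul_snd, smul_eq_mul]
    field_simp
    linear_combination u.1 * h'

/-- Let a closed curve around the origin, met once by each ray, be the level set `g = 1` of a gauge
`g`, and let it be divided by finitely many vertices into finitely many segments. Orient each
segment counterclockwise; then each vertex is the head of exactly one segment, so there are as many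
segments as vertices. -/
theorem card_edges_eq_card_vertices {ι : Type*} [Fintype ι] {g : ℝ × ℝ → ℝ} (hg : Continuous g)
    (hhom : ∀ t : ℝ, 0 ≤ t → ∀ w, g (t • w) = t * g w) (hpos : ∀ w ≠ 0, 0 < g w)
    (V : Finset (ℝ × ℝ)) (a b : ι → ℝ × ℝ) (hab : ∀ i, a i ≠ b i) (ha : ∀ i, a i ∈ V)
    (hb : ∀ i, b i ∈ V) (hV : ∀ v ∈ V, g v = 1)
    (hE : ∀ i, ∀ x ∈ openSegment ℝ (a i) (b i), g x = 1)
    (hdisj : ∀ i j x, x ∈ openSegment ℝ (a i) (b i) → x ∈ openSegment ℝ (a j) (b j) → i = j)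
    (hVE : ∀ i, ∀ x ∈ openSegment ℝ (a i) (b i), x ∉ V)
    (hcover : ∀ x, g x = 1 → x ∈ V ∨ ∃ i, x ∈ openSegment ℝ (a i) (b i)) :
    Fintype.card ι = V.card := by
  have hg0 : g 0 = 0 := by simpa using hhom 0 le_rfl 0
  have hne0 : ∀ x, g x = 1 → x ≠ 0 := by
    rintro x hx rfl
    rw [hg0] at hx
    exact zero_ne_one hx
  have hray : ∀ x, g x = 1 → ∀ t : ℝ, 0 ≤ t → g (t • x) = 1 → t = 1 := by
    intro x hx t ht h
    rwa [hhom t ht, hx, mul_one] at h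
  have hdet : ∀ i, planeDet (a i) (b i) ≠ 0 := by
    intro i h0
    have ha1 := hV _ (ha i)
    obtain ⟨c, hc⟩ := exists_eq_smul_of_planeDet_eq_zero h0 (hne0 _ ha1)
    rcases le_or_gt 0 c with hc0 | hc0
    · have := hray _ ha1 c hc0 (hc ▸ hV _ (hb i))
      rw [this, one_smul] at hc
      exact hab i hc.symm
    · have h1 : (1 : ℝ) - c ≠ 0 := by linarith
      refine hne0 0 (hE i 0 ?_) rfl
      refine ⟨-c / (1 - c), 1 / (1 - c), div_pos (by linarith) (by linarith),
        div_pos one_pos (by linarith), by field_simp; ring, ?_⟩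
      rw [hc, smul_smul, ← add_smul]
      convert zero_smul ℝ (a i) using 2
      field_simp
      ring
  -- `t i` is the tail and `h i` the head of the edge `i`, oriented counterclockwise
  have horient : ∀ i, ∃ t h, 0 < planeDet t h ∧ t ∈ V ∧ h ∈ V ∧
      openSegment ℝ t h = openSegment ℝ (a i) (b i) := by
    intro i
    rcases lt_or_gt_of_ne (hdet i) with hlt | hgt
    · refine ⟨b i, a i, ?_, hb i, ha i, openSegment_symm ℝ _ _⟩
      simp only [planeDet] at hlt ⊢
      linarith
    · exact ⟨a i, b i, hgt, ha i, hb i, rfl⟩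
  choose t h hth ht hh hseg using horient
  -- if two edges have the same head, the tail of one is not hidden behind the other
  have hhidden : ∀ i j, h i = h j → ¬ 0 < planeDet (t i) (t j) := by
    intro i j hij hlt
    have hα := hth j
    rw [← hij] at hα
    have hβ := hth i
    have hcr := planeDet_smul_eq (t i) (h i) (t j)
    set A := planeDet (t j) (h i)
    set B := planeDet (t i) (t j)
    set D := planeDet (t i) (h i)
    have hx : (D / (A + B)) • t j ∈ openSegment ℝ (t i) (h i) := by
      refine ⟨A / (A + B), B / (A + B), by positivity, by positivity, by field_simp, ?_⟩
      rw [div_eq_inv_mul D, mul_smul, hcr, smul_add, smul_smul, smul_smul, div_eq_inv_mul,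
        div_eq_inv_mul]
    have h1 := hray _ (hV _ (ht j)) _ (by positivity) (hE i _ (hseg i ▸ hx))
    rw [h1, one_smul] at hx
    exact hVE i _ (hseg i ▸ hx) (ht j)
  refine Finset.card_bij (fun i _ => h i) (fun i _ => hh i) (fun i _ j _ hij => ?_)
    (fun v hv => ?_)
  · have hnot := hhidden i j hij
    have hnot' := hhidden j i hij.symm
    have hanti : planeDet (t j) (t i) = -planeDet (t i) (t j) := by
      simp only [planeDet]; ring
    have h0 : planeDet (t i) (t j) = 0 := by
      rw [hanti] at hnot'
      linarith
    obtain ⟨c, hc⟩ := exists_eq_smul_of_planeDet_eq_zero h0 (hne0 _ (hV _ (ht i)))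
    have hcpos : 0 < c := by
      have h1 := hth j
      rw [← hij, hc] at h1
      have h2 : planeDet (c • t i) (h i) = c * planeDet (t i) (h i) := by
        simp [planeDet]; ring
      rw [h2] at h1
      exact pos_of_mul_pos_left h1 (hth i).le
    have hc1 := hray _ (hV _ (ht i)) c hcpos.le (hc ▸ hV _ (ht j))
    rw [hc1, one_smul] at hc
    have hs : openSegment ℝ (a i) (b i) = openSegment ℝ (a j) (b j) := by
      rw [← hseg i, ← hseg j, hc, hij]
    have hm := midpoint_mem_openSegment (𝕜 := ℝ) (a i) (b i)
    exact hdisj i j _ hm (hs ▸ hm)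
  · -- approach `v` clockwise along the curve
    have hgv := hV v hv
    have hv0 := hne0 v hgv
    set w : ℝ × ℝ := (v.2, -v.1) with hw
    have hdw : ∀ s : ℝ, planeDet (v + s • w) v = s * (v.1 ^ 2 + v.2 ^ 2) := by
      intro s; simp [planeDet, hw]; ring
    have hv2 : 0 < v.1 ^ 2 + v.2 ^ 2 := by
      by_contra hcon
      have h1 : v.1 = 0 := by nlinarith [sq_nonneg v.1, sq_nonneg v.2]
      have h2 : v.2 = 0 := by nlinarith [sq_nonneg v.1, sq_nonneg v.2]
      exact hv0 (Prod.ext h1 h2)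
    let X : ℝ → ℝ × ℝ := fun s => (g (v + s • w))⁻¹ • (v + s • w)
    have hXlim : Tendsto X (𝓝[>] 0) (𝓝 v) := by
      have hc : ContinuousAt X 0 := by
        have h1 : Continuous fun s : ℝ => g (v + s • w) := by fun_prop
        refine ContinuousAt.smul (h1.continuousAt.inv₀ ?_) (by fun_prop)
        simp [hgv]
      have : X 0 = v := by simp [X, hgv]
      rw [← this]
      exact hc.tendsto.mono_left nhdsWithin_le_nhds
    have hX : ∀ s : ℝ, 0 < s → g (X s) = 1 ∧ 0 < planeDet (X s) v := by
      intro s hs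
      have hne : v + s • w ≠ 0 := by
        intro h0
        have h1 := hdw s
        rw [h0] at h1
        have : 0 < s * (v.1 ^ 2 + v.2 ^ 2) := by positivity
        rw [← h1] at this
        simp [planeDet] at this
      have hgp := hpos _ hne
      refine ⟨by rw [hhom _ (by positivity), inv_mul_cancel₀ hgp.ne'], ?_⟩
      have : planeDet (X s) v = (g (v + s • w))⁻¹ * planeDet (v + s • w) v := by
        simp [planeDet, X]; ring
      rw [this, hdw]
      positivity
    have hev1 : ∀ᶠ s in 𝓝[>] (0 : ℝ), ∀ u ∈ V, u ≠ v → X s ≠ u := by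
      rw [Filter.eventually_all_finset]
      intro u _
      by_cases huv : u = v
      · exact Eventually.of_forall fun _ hne => absurd huv hne
      · exact (hXlim.eventually_ne (Ne.symm huv)).mono fun s hs _ => hs
    have hev2 : ∀ᶠ s in 𝓝[>] (0 : ℝ), ∀ i, v ∉ segment ℝ (t i) (h i) →
        X s ∉ segment ℝ (t i) (h i) := by
      rw [Filter.eventually_all]
      intro i
      by_cases hvi : v ∈ segment ℝ (t i) (h i)
      · exact Eventually.of_forall fun _ hne => absurd hvi hne
      · have hcl : IsClosed (segment ℝ (t i) (h i)) := by
          rw [← convexHull_pair]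
          exact ((Set.toFinite _).isCompact_convexHull ℝ).isClosed
        exact (hXlim.eventually (hcl.isOpen_compl.mem_nhds hvi)).mono fun s hs _ => hs
    obtain ⟨s, ⟨hs1, hs2⟩, hs⟩ := ((hev1.and hev2).and self_mem_nhdsWithin).exists
    obtain ⟨hgs, hds⟩ := hX s hs
    have hXv : X s ≠ v := by
      intro hXv
      rw [hXv] at hds
      simp [planeDet, mul_comm] at hds
    rcases hcover _ hgs with hmem | ⟨i, hi⟩
    · exact absurd rfl (hs1 _ hmem hXv)
    · rw [← hseg i] at hi
      have hvi : v ∈ segment ℝ (t i) (h i) := by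
        by_contra hcon
        exact hs2 i hcon (openSegment_subset_segment ℝ _ _ hi)
      refine ⟨i, Finset.mem_univ i, ?_⟩
      by_contra hne
      have hvt : t i = v := by
        by_contra hne'
        exact hVE i v (hseg i ▸ mem_openSegment_of_ne_left_right hne' hne hvi) hv
      obtain ⟨α, β, hα, hβ, -, hαβ⟩ := hi
      have : planeDet (X s) v = -(β * planeDet (t i) (h i)) := by
        rw [← hαβ, hvt]; simp [planeDet]; ring
      have := mul_pos hβ (hth i)
      linarith

end Polygon

namespace EmbeddedPolyhedron

variable {M : EmbeddedPolyhedron} {C D e F : Set Space3} {x p : Space3}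

/-- The edges contained in `F`. -/
def edgesOf (M : EmbeddedPolyhedron) (F : Set Space3) : Set (Set Space3) :=
  {e ∈ M.cells | cellDim e = 1 ∧ e ⊆ F}

/-- The vertices contained in `F`. -/
def verticesOf (M : EmbeddedPolyhedron) (F : Set Space3) : Set Space3 :=
  {p ∈ M.vertices | p ∈ F}

theorem edgesOf_finite (hF : F ∈ M.cells) : (M.edgesOf F).Finite :=
  (finite_subcells hF).subset fun _ he => ⟨he.1, he.2.2⟩

theorem verticesOf_finite (hF : F ∈ M.cells) : (M.verticesOf F).Finite := by
  refine Set.Finite.of_finite_image ((finite_subcells hF).subset ?_)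
    (Set.singleton_injective.injOn (s := M.verticesOf F))
  rintro _ ⟨p, hp, rfl⟩
  exact ⟨hp.1, by simpa using hp.2⟩

theorem mem_vertex_or_edge_of_mem_intrinsicFrontier (hF : F ∈ M.cells)
    (hx : x ∈ intrinsicFrontier ℝ F) :
    x ∈ M.verticesOf F ∨ ∃ e ∈ M.edgesOf F, x ∈ intrinsicInterior ℝ e := by
  rw [intrinsicFrontier_eq_sdiff (isClosed_cell hF)] at hx
  obtain ⟨D, hD, hDF, hxD⟩ := exists_mem_intrinsicInterior hF hx.1
  have hne : D ≠ F := by rintro rfl; exact hx.2 hxD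
  have hlt := cellDim_lt_of_ssubset hF hD hDF hne
  have h2 := cellDim_le_two hF
  rcases Nat.lt_succ_iff_lt_or_eq.1 (lt_of_lt_of_le hlt h2) with h0 | h1
  · obtain ⟨p, hp, rfl⟩ := exists_eq_singleton hD (by omega)
    have hxp := intrinsicInterior_subset hxD
    rw [Set.mem_singleton_iff] at hxp
    subst hxp
    exact .inl ⟨hp, hx.1⟩
  · exact .inr ⟨D, ⟨hD, h1, hDF⟩, hxD⟩

/-- An affine parametrization of the plane of a face, centred at an interior point of the face,
together with the gauge whose unit circle is the boundary of the face. -/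
theorem exists_face_gauge (hF : F ∈ M.cells) (h2 : cellDim F = 2) :
    ∃ (Φ : (ℝ × ℝ) →ᵃ[ℝ] Space3) (g : ℝ × ℝ → ℝ), Function.Injective Φ ∧ Continuous g ∧
      (∀ t : ℝ, 0 ≤ t → ∀ w, g (t • w) = t * g w) ∧ (∀ w ≠ 0, 0 < g w) ∧
      (∀ x ∈ F, ∃ w, Φ w = x) ∧ ∀ w, Φ w ∈ intrinsicFrontier ℝ F ↔ g w = 1 := by
  obtain ⟨o, ho⟩ := intrinsicInterior_cell_nonempty hF
  have hoF := intrinsicInterior_subset ho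
  let ψ : (ℝ × ℝ) ≃L[ℝ] vectorSpan ℝ F := (LinearEquiv.ofFinrankEq (ℝ × ℝ) (vectorSpan ℝ F) (by
    simp only [Module.finrank_prod, Module.finrank_self]; exact h2.symm)).toContinuousLinearEquiv
  let φ : (ℝ × ℝ) →L[ℝ] Space3 := (vectorSpan ℝ F).subtypeL.comp ψ.toContinuousLinearMap
  have hφ : ∀ w, φ w = (ψ w : Space3) := fun w => rfl
  let Φ : (ℝ × ℝ) →ᵃ[ℝ] Space3 := φ.toLinearMap.toAffineMap + AffineMap.const ℝ (ℝ × ℝ) o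
  have hΦ : ∀ w, Φ w = o + ψ w := fun w => by simp [Φ, hφ, add_comm]
  have hΦc : Continuous Φ := by
    have : (Φ : ℝ × ℝ → Space3) = fun w => o + φ w := funext hΦ
    rw [this]
    fun_prop
  have hΦinj : Function.Injective Φ := by
    intro u w huw
    rw [hΦ, hΦ, add_right_inj] at huw
    exact ψ.injective (Subtype.ext huw)
  have hsurj : ∀ x ∈ F, ∃ w, Φ w = x := by
    intro x hx
    refine ⟨ψ.symm ⟨x - o, vsub_mem_vectorSpan ℝ hx hoF⟩, ?_⟩
    rw [hΦ]
    simp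
  have hint : ∀ w, Φ w ∈ intrinsicInterior ℝ F ↔ w ∈ interior (Φ ⁻¹' F) := by
    intro w
    rw [mem_intrinsicInterior_iff_exists_ball, mem_interior_iff_mem_nhds]
    constructor
    · rintro ⟨-, ε, hε, hball⟩
      have hc : Tendsto (fun u => ‖(ψ (u - w) : Space3)‖) (𝓝 w) (𝓝 0) := by
        have : Continuous fun u => ‖(ψ (u - w) : Space3)‖ := by fun_prop
        simpa using this.tendsto w
      filter_upwards [hc.eventually (gt_mem_nhds hε)] with u hu
      have := hball _ (ψ (u - w)).2 hu
      rw [Set.mem_preimage]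
      convert this using 1
      rw [hΦ, hΦ, map_sub]
      simp
    · intro hw
      refine ⟨(mem_of_mem_nhds hw : w ∈ Φ ⁻¹' F), ?_⟩
      have hc : Tendsto (fun v : vectorSpan ℝ F => w + ψ.symm v) (𝓝 0) (𝓝 w) := by
        have : Continuous fun v : vectorSpan ℝ F => w + ψ.symm v := by fun_prop
        simpa using this.tendsto 0
      obtain ⟨ε, hε, hball⟩ := Metric.mem_nhds_iff.1 (hc hw)
      refine ⟨ε, hε, fun v hv hvε => ?_⟩
      have h1 : (⟨v, hv⟩ : vectorSpan ℝ F) ∈ Metric.ball 0 ε := by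
        rw [mem_ball_zero_iff]; exact hvε
      have h3 : Φ (w + ψ.symm ⟨v, hv⟩) ∈ F := hball h1
      rw [hΦ, map_add, ψ.apply_symm_apply] at h3
      rw [hΦ]
      simpa [add_assoc] using h3
  have hconv : Convex ℝ (Φ ⁻¹' F) := (convex_cell hF).affine_preimage Φ
  have hclosed : IsClosed (Φ ⁻¹' F) := (isClosed_cell hF).preimage hΦc
  have h0 : Φ ⁻¹' F ∈ 𝓝 0 := by
    rw [← mem_interior_iff_mem_nhds, ← hint, hΦ]
    simpa using ho
  have hbdd : Bornology.IsBounded (Φ ⁻¹' F) := by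
    have hcomp : IsCompact ((fun v : vectorSpan ℝ F => (v : Space3)) ⁻¹' ((fun x => o + x) ⁻¹' F)) := by
      refine (Submodule.closed_of_finiteDimensional _).isClosedEmbedding_subtypeVal.isCompact_preimage ?_
      exact (Homeomorph.addLeft o).isClosedEmbedding.isCompact_preimage (isCompact_cell hF)
    refine ((hcomp.image ψ.symm.continuous).isBounded).subset fun w hw => ?_
    refine ⟨ψ w, ?_, by simp⟩
    rw [Set.mem_preimage, hΦ] at hw
    exact hw
  refine ⟨Φ, gauge (Φ ⁻¹' F), hΦinj, continuous_gauge hconv h0, fun t ht w => ?_, fun w hw => ?_,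
    hsurj, fun w => ?_⟩
  · rw [gauge_smul_of_nonneg ht, smul_eq_mul]
  · exact (gauge_pos (absorbent_nhds_zero h0)
      (NormedSpace.isVonNBounded_of_isBounded _ hbdd)).2 hw
  · rw [gauge_eq_one_iff_mem_frontier hconv h0, hclosed.frontier_eq, Set.mem_sdiff, ← hint,
      intrinsicFrontier_eq_sdiff (isClosed_cell hF)]
    rfl

theorem notMem_intrinsicInterior_of_subset_face (hF : F ∈ M.cells) (hC : C ∈ M.cells)
    (hne : C ≠ F) (hx : x ∈ intrinsicInterior ℝ C) : x ∉ intrinsicInterior ℝ F := fun h =>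
  hne (eq_of_mem_intrinsicInterior hC hF hx h)

theorem ncard_edgesOf_eq_ncard_verticesOf (hF : F ∈ M.cells) (h2 : cellDim F = 2) :
    (M.edgesOf F).ncard = (M.verticesOf F).ncard := by
  classical
  obtain ⟨Φ, g, hinj, hg, hhom, hpos, hsurj, hfr⟩ := exists_face_gauge hF h2
  have hfront : ∀ {C x}, C ∈ M.cells → C ⊆ F → cellDim C ≠ 2 → x ∈ intrinsicInterior ℝ C →
      x ∈ intrinsicFrontier ℝ F := by
    intro C x hC hCF hne hx
    rw [intrinsicFrontier_eq_sdiff (isClosed_cell hF)]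
    refine ⟨hCF (intrinsicInterior_subset hx), notMem_intrinsicInterior_of_subset_face hF hC ?_ hx⟩
    rintro rfl
    exact hne h2
  have hVfin := verticesOf_finite hF
  have hEfin := edgesOf_finite hF
  have : Fintype (M.edgesOf F) := hEfin.fintype
  choose a b hab hseg hint ha hb using
    fun e : M.edgesOf F => exists_edge_endpoints e.2.1 e.2.2.1
  have haF : ∀ e, a e ∈ F := fun e => e.2.2.2 (by
    have := left_mem_segment ℝ (a e) (b e); rwa [← hseg] at this)
  have hbF : ∀ e, b e ∈ F := fun e => e.2.2.2 (by
    have := right_mem_segment ℝ (a e) (b e); rwa [← hseg] at this)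
  choose a' ha' using fun e => hsurj _ (haF e)
  choose b' hb' using fun e => hsurj _ (hbF e)
  let V : Finset (ℝ × ℝ) := hVfin.toFinset.preimage Φ hinj.injOn
  have hmemV : ∀ v, v ∈ V ↔ Φ v ∈ M.verticesOf F := fun v => by simp [V]
  have hopen : ∀ e x, x ∈ openSegment ℝ (a' e) (b' e) ↔
      Φ x ∈ intrinsicInterior ℝ (e : Set Space3) := by
    intro e x
    rw [hint, ← ha', ← hb', ← image_openSegment, hinj.mem_set_image]
  have hcard : V.card = (M.verticesOf F).ncard := by
    rw [Set.ncard_eq_toFinset_card _ hVfin]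
    refine Finset.card_bij (fun v _ => Φ v) (fun v hv => by simpa using (hmemV v).1 hv)
      (fun v _ w _ h => hinj h) (fun x hx => ?_)
    rw [Set.Finite.mem_toFinset] at hx
    obtain ⟨v, rfl⟩ := hsurj x hx.2
    exact ⟨v, (hmemV v).2 hx, rfl⟩
  rw [← hcard, ← Nat.card_coe_set_eq (M.edgesOf F), Nat.card_eq_fintype_card]
  refine card_edges_eq_card_vertices hg hhom hpos V a' b' (fun e h => hab e ?_) (fun e => ?_)
    (fun e => ?_) (fun v hv => ?_) (fun e x hx => ?_) (fun e₁ e₂ x h₁ h₂ => ?_) (fun e x hx hxV => ?_)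
    (fun x hx => ?_)
  · rw [← ha', ← hb', h]
  · rw [hmemV, ha']; exact ⟨ha e, haF e⟩
  · rw [hmemV, hb']; exact ⟨hb e, hbF e⟩
  · have hv' := (hmemV v).1 hv
    rw [← hfr]
    exact hfront hv'.1 (by simpa using hv'.2) (by rw [cellDim_singleton]; norm_num) (by simp)
  · rw [← hfr]
    refine hfront e.2.1 e.2.2.2 ?_ ((hopen e x).1 hx)
    rw [e.2.2.1]; norm_num
  · exact Subtype.ext (eq_of_mem_intrinsicInterior e₁.2.1 e₂.2.1 ((hopen _ x).1 h₁) ((hopen _ x).1 h₂))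
  · refine notMem_intrinsicInterior_of_vertex e.2.1 ?_ ((hmemV x).1 hxV).1 ((hopen e x).1 hx)
    rw [e.2.2.1]; norm_num
  · rcases mem_vertex_or_edge_of_mem_intrinsicFrontier hF ((hfr x).2 hx) with h | ⟨e, he, hxe⟩
    · exact .inl ((hmemV x).2 h)
    · exact .inr ⟨⟨e, he⟩, (hopen ⟨e, he⟩ x).2 hxe⟩

theorem edgesOf_nonempty (hF : F ∈ M.cells) (h2 : cellDim F = 2) : (M.edgesOf F).Nonempty := by
  obtain ⟨Φ, g, hinj, hg, hhom, hpos, hsurj, hfr⟩ := exists_face_gauge hF h2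
  have h1 := hpos (1, 0) (by simp)
  have hx : Φ ((g (1, 0))⁻¹ • (1, 0)) ∈ intrinsicFrontier ℝ F := by
    rw [hfr, hhom _ (by positivity), inv_mul_cancel₀ h1.ne']
  rcases mem_vertex_or_edge_of_mem_intrinsicFrontier hF hx with h | ⟨e, he, -⟩
  · rw [← Set.ncard_pos (edgesOf_finite hF), ncard_edgesOf_eq_ncard_verticesOf hF h2,
      Set.ncard_pos (verticesOf_finite hF)]
    exact ⟨_, h⟩
  · exact ⟨e, he⟩

end EmbeddedPolyhedron

/-! ### Leaves in the star of a vertex -/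

theorem infinite_segment {E : Type*} [AddCommGroup E] [Module ℝ E] {x y : E} (h : x ≠ y) :
    (segment ℝ x y).Infinite := by
  rw [segment_eq_image']
  refine (Set.Icc_infinite zero_lt_one).image fun s _ t _ hst => ?_
  have h0 : (s - t) • (y - x) = 0 := by
    rw [sub_smul, sub_eq_zero]
    exact add_left_cancel hst
  rcases smul_eq_zero.1 h0 with h1 | h1
  · exact sub_eq_zero.1 h1
  · exact absurd (sub_eq_zero.1 h1).symm h

theorem apply_eq_of_mem_segment {E : Type*} [AddCommGroup E] [Module ℝ E] (ω : E →ₗ[ℝ] ℝ)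
    {x y z : E} {c : ℝ} (hx : ω x = c) (hy : ω y = c) (hz : z ∈ segment ℝ x y) : ω z = c := by
  obtain ⟨a, b, -, -, hab, rfl⟩ := hz
  rw [map_add, map_smul, map_smul, hx, hy, ← add_smul, hab, one_smul]

namespace EmbeddedPolyhedron

variable {M : EmbeddedPolyhedron} {C D e F : Set Space3} {x y p q : Space3} {ω : Space3 →ₗ[ℝ] ℝ}

theorem IsGeneric.neg (hω : M.IsGeneric ω) : M.IsGeneric (-ω) := by
  rintro C hC h1 ⟨c, hc⟩
  refine hω C hC h1 ⟨-c, fun x hx => ?_⟩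
  rw [← hc x hx]
  simp

theorem IsGeneric.injOn_edge (hω : M.IsGeneric ω) (he : e ∈ M.cells) (h1 : cellDim e = 1) :
    Set.InjOn ω e := by
  obtain ⟨a, b, hab, hseg⟩ := exists_eq_segment_of_cellDim_eq_one he h1
  rw [hseg, segment_eq_image']
  rintro _ ⟨s, -, rfl⟩ _ ⟨t, -, rfl⟩ hst
  simp only [map_add, map_smul, smul_eq_mul] at hst
  have h0 : (s - t) * ω (b - a) = 0 := by linarith
  rcases mul_eq_zero.1 h0 with h | h
  · rw [sub_eq_zero.1 h]
  · refine absurd ⟨ω a, fun x hx => ?_⟩ (hω e he h1)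
    rw [hseg, segment_eq_image'] at hx
    obtain ⟨r, -, rfl⟩ := hx
    simp [h]

theorem IsGeneric.not_const_face (hω : M.IsGeneric ω) (hF : F ∈ M.cells) (h2 : cellDim F = 2)
    (c : ℝ) : ¬ ∀ x ∈ F, ω x = c := by
  intro h
  obtain ⟨e, he⟩ := edgesOf_nonempty hF h2
  exact hω e he.1 he.2.1 ⟨c, fun x hx => h x (he.2.2 hx)⟩

/-- A level segment of a generic form in a face passes through the interior of the face, since it
meets each vertex and each edge in at most one point. -/
theorem IsGeneric.exists_mem_segment_intrinsicInterior (hω : M.IsGeneric ω) (hF : F ∈ M.cells)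
    (hpq : p ≠ q) (hsub : segment ℝ p q ⊆ F) (hlev : ω p = ω q) :
    ∃ z ∈ segment ℝ p q, z ∈ intrinsicInterior ℝ F := by
  by_contra! hcon
  apply infinite_segment hpq
  have hfin : {D ∈ M.cells | D ⊆ F ∧ D ≠ F}.Finite :=
    (finite_subcells hF).subset fun D hD => ⟨hD.1, hD.2.1⟩
  refine (hfin.biUnion (t := fun D => segment ℝ p q ∩ D) fun D hD => ?_).subset fun z hz => ?_
  · apply Set.Subsingleton.finite
    have hlt := cellDim_lt_of_ssubset hF hD.1 hD.2.1 hD.2.2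
    have h2 := cellDim_le_two hF
    rcases Nat.lt_succ_iff_lt_or_eq.1 (lt_of_lt_of_le hlt h2) with h0 | h1
    · exact (subsingleton_of_cellDim_eq_zero (by omega)).anti Set.inter_subset_right
    · intro u hu v hv
      exact hω.injOn_edge hD.1 h1 hu.2 hv.2 ((apply_eq_of_mem_segment ω hlev rfl hu.1).trans
        (apply_eq_of_mem_segment ω hlev rfl hv.1).symm)
  · obtain ⟨D, hD, hDF, hzD⟩ := exists_mem_intrinsicInterior hF (hsub hz)
    refine Set.mem_iUnion₂.2 ⟨D, ⟨hD, hDF, ?_⟩, hz, intrinsicInterior_subset hzD⟩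
    rintro rfl
    exact hcon z hz hzD

/-- The level sets of a generic form in a face are contained in lines. -/
theorem IsGeneric.exists_sub_eq_smul_sub (hω : M.IsGeneric ω) (hF : F ∈ M.cells)
    (h2 : cellDim F = 2) (hp : p ∈ F) (hx : x ∈ F) (hy : y ∈ F) (hxp : x ≠ p) (hωx : ω x = ω p)
    (hωy : ω y = ω p) : ∃ c : ℝ, y - p = c • (x - p) := by
  let f : vectorSpan ℝ F →ₗ[ℝ] ℝ := ω.domRestrict _
  have hf : f ≠ 0 := by
    intro h0
    refine hω.not_const_face hF h2 (ω p) fun z hz => ?_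
    have h1 : f ⟨z - p, vsub_mem_vectorSpan ℝ hz hp⟩ = 0 := by rw [h0]; rfl
    have h3 : ω (z - p) = 0 := h1
    rw [map_sub] at h3
    linarith
  have hker : Module.finrank ℝ (LinearMap.ker f) = 1 := by
    have h1 := Module.Dual.finrank_ker_add_one_of_ne_zero (f := f) hf
    have h3 : Module.finrank ℝ (vectorSpan ℝ F) = 2 := h2
    omega
  let u : LinearMap.ker f := ⟨⟨x - p, vsub_mem_vectorSpan ℝ hx hp⟩, by simp [f, hωx]⟩
  let v : LinearMap.ker f := ⟨⟨y - p, vsub_mem_vectorSpan ℝ hy hp⟩, by simp [f, hωy]⟩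
  have hu : u ≠ 0 := by
    intro h0
    have h1 : x - p = 0 := congrArg (fun w : LinearMap.ker f => ((w : vectorSpan ℝ F) : Space3)) h0
    exact hxp (sub_eq_zero.1 h1)
  obtain ⟨c, hc⟩ := (finrank_eq_one_iff_of_nonzero' u hu).1 hker v
  exact ⟨c, (congrArg (fun w : LinearMap.ker f => ((w : vectorSpan ℝ F) : Space3)) hc).symm⟩

/-- The faces at `p` in which the linear form takes values on both sides of its value at `p`. -/
def facesCut (M : EmbeddedPolyhedron) (ω : Space3 →ₗ[ℝ] ℝ) (p : Space3) : Set (Set Space3) :=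
  {F ∈ M.cells | cellDim F = 2 ∧ p ∈ F ∧ (∃ x ∈ F, ω x < ω p) ∧ ∃ y ∈ F, ω p < ω y}

theorem exists_mem_facesCut_of_mem_cutSegments (hω : M.IsGeneric ω) {T : Set Space3}
    (hT : T ∈ M.cutSegments ω p) : ∃ F ∈ M.facesCut ω p, T ⊆ F := by
  obtain ⟨⟨⟨q, hqp, rfl⟩, hsub⟩, -⟩ := hT
  obtain ⟨hq, -, hlev⟩ := hsub (right_mem_segment ℝ p q)
  simp only [closedStar, Set.mem_iUnion, exists_prop] at hq
  obtain ⟨G, ⟨hG, hpG⟩, hqG⟩ := hq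
  have hTG : segment ℝ p q ⊆ G := (convex_cell hG).segment_subset hpG hqG
  have h2 : cellDim G = 2 := by
    have hle := cellDim_le_two hG
    have h0 : cellDim G ≠ 0 := fun h => hqp (subsingleton_of_cellDim_eq_zero h hqG hpG)
    have h1 : cellDim G ≠ 1 := fun h => hqp (hω.injOn_edge hG h hqG hpG hlev)
    omega
  obtain ⟨z, hz, hzG⟩ := hω.exists_mem_segment_intrinsicInterior hG hqp.symm hTG hlev.symm
  have hωz : ω z = ω p := apply_eq_of_mem_segment ω rfl hlev hz
  refine ⟨G, ⟨hG, h2, hpG, ?_, ?_⟩, hTG⟩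
  · by_contra! hcon
    refine hω.not_const_face hG h2 (ω z) fun x hx => ?_
    have := eq_of_isMaxOn_intrinsicInterior (-ω) hzG (fun y hy => by
      simpa [hωz] using hcon y hy) x hx
    simpa using this
  · by_contra! hcon
    exact hω.not_const_face hG h2 (ω z) (eq_of_isMaxOn_intrinsicInterior ω hzG fun y hy => by
      simpa [hωz] using hcon y hy)

theorem exists_mem_cutSegments_of_mem_facesCut (hp : p ∈ M.vertices) (hF : F ∈ M.facesCut ω p) :
    ∃ T ∈ M.cutSegments ω p, T ⊆ F := by
  obtain ⟨hF, h2, hpF, ⟨x, hx, hxp⟩, ⟨y, hy, hyp⟩⟩ := hF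
  have hpint : p ∉ intrinsicInterior ℝ F :=
    notMem_intrinsicInterior_of_vertex hF (by omega) hp
  obtain ⟨z, hz, hωz⟩ : ∃ z ∈ intrinsicInterior ℝ F, ω z = ω p := by
    obtain ⟨o, ho⟩ := intrinsicInterior_cell_nonempty hF
    have key : ∀ w ∈ F, ∀ t : ℝ, 0 < t → t < 1 → t * (ω o - ω w) = ω o - ω p →
        ∃ z ∈ intrinsicInterior ℝ F, ω z = ω p := by
      intro w hw t h0 h1 ht
      refine ⟨_, (convex_cell hF).add_smul_mem_intrinsicInterior ho hw h0.le h1, ?_⟩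
      simp only [map_add, map_smul, map_sub, smul_eq_mul]
      linarith
    rcases lt_trichotomy (ω o) (ω p) with h | h | h
    · have hd : 0 < ω y - ω o := by linarith
      refine key y hy ((ω p - ω o) / (ω y - ω o)) (div_pos (by linarith) hd)
        ((div_lt_one hd).2 (by linarith)) ?_
      field_simp
      ring
    · exact ⟨o, ho, h⟩
    · have hd : 0 < ω o - ω x := by linarith
      refine key x hx ((ω o - ω p) / (ω o - ω x)) (div_pos (by linarith) hd)
        ((div_lt_one hd).2 (by linarith)) ?_
      field_simp
  have hzp : z ≠ p := by rintro rfl; exact hpint hz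
  set d := z - p with hd
  have hd0 : d ≠ 0 := sub_ne_zero.2 hzp
  have hωd : ω d = 0 := by rw [hd, map_sub, hωz, sub_self]
  have hcomp : IsCompact {t : ℝ | p + t • d ∈ F} := by
    refine Metric.isCompact_of_isClosed_isBounded ((isClosed_cell hF).preimage (by fun_prop)) ?_
    obtain ⟨R, hR⟩ := (isCompact_cell hF).isBounded.subset_closedBall p
    refine (Metric.isBounded_closedBall (x := (0 : ℝ)) (r := R / ‖d‖)).subset fun t ht => ?_
    have h1 := hR ht
    rw [Metric.mem_closedBall, dist_eq_norm, add_sub_cancel_left, norm_smul] at h1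
    rw [mem_closedBall_zero_iff, le_div_iff₀ (norm_pos_iff.2 hd0)]
    exact h1
  have h1mem : (1 : ℝ) ∈ {t : ℝ | p + t • d ∈ F} := by
    have : p + (1 : ℝ) • d = z := by rw [hd]; module
    rw [Set.mem_ofPred_eq, this]
    exact intrinsicInterior_subset hz
  obtain ⟨t, ht, htmax⟩ := hcomp.exists_isGreatest ⟨1, h1mem⟩
  have ht1 : 1 ≤ t := htmax h1mem
  have hTF : segment ℝ p (p + t • d) ⊆ F := (convex_cell hF).segment_subset hpF ht
  have hsub : segment ℝ p (p + t • d) ⊆ closedStar M.cells p ∩ M.leaf ω p := by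
    intro u hu
    have huF := hTF hu
    refine ⟨Set.mem_iUnion₂.2 ⟨F, ⟨hF, hpF⟩, huF⟩, ⟨F, hF, huF⟩, ?_⟩
    exact apply_eq_of_mem_segment ω rfl (by simp [hωd]) hu
  refine ⟨_, ⟨⟨⟨_, ?_, rfl⟩, hsub⟩, ?_⟩, hTF⟩
  · intro h
    have h' : t • d = 0 := by simpa using h
    rcases smul_eq_zero.1 h' with h | h
    · linarith
    · exact hd0 h
  · -- a longer segment would leave `F`, as it still lies in a single cell of the star
    rintro _ ⟨⟨q, hqp, rfl⟩, hqsub⟩ hle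
    have hmem := hle (right_mem_segment ℝ p (p + t • d))
    rw [segment_eq_image'] at hmem
    obtain ⟨s, ⟨hs0, hs1⟩, hs⟩ := hmem
    have hs' : s • (q - p) = t • d := add_left_cancel hs
    have hspos : 0 < s := by
      refine lt_of_le_of_ne hs0 ?_
      rintro rfl
      rw [zero_smul] at hs'
      rcases smul_eq_zero.1 hs'.symm with h | h
      · linarith
      · exact hd0 h
    have hqd : q = p + (t / s) • d := by
      rw [div_eq_inv_mul, mul_smul, ← hs', inv_smul_smul₀ hspos.ne']
      abel
    obtain ⟨hqstar, -⟩ := hqsub (right_mem_segment ℝ p q)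
    simp only [closedStar, Set.mem_iUnion, exists_prop] at hqstar
    obtain ⟨G, ⟨hG, hpG⟩, hqG⟩ := hqstar
    have hzG : z ∈ G := by
      have := (convex_cell hG).add_smul_sub_mem hpG hqG (t := s / t)
        ⟨by positivity, (div_le_one (by linarith)).2 (by linarith)⟩
      convert this using 1
      rw [hqd, add_sub_cancel_left, smul_smul, show s / t * (t / s) = 1 by field_simp, hd]
      module
    have hFG := face_eq_of_mem_intrinsicInterior hG hF h2 hzG hz
    subst hFG
    have hle2 : t / s ≤ t := htmax (by rw [Set.mem_ofPred_eq, ← hqd]; exact hqG)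
    have hs1' : s = 1 := by
      rw [div_le_iff₀ hspos] at hle2
      nlinarith
    rw [hs1', div_one] at hqd
    rw [hqd]

theorem eq_of_mem_cutSegments (hω : M.IsGeneric ω) (hp : p ∈ M.vertices) (hF : F ∈ M.cells)
    (h2 : cellDim F = 2) {T T' : Set Space3} (hT : T ∈ M.cutSegments ω p)
    (hT' : T' ∈ M.cutSegments ω p) (hTF : T ⊆ F) (hTF' : T' ⊆ F) : T = T' := by
  obtain ⟨⟨⟨q, hqp, rfl⟩, hsub⟩, hmax⟩ := id hT
  obtain ⟨⟨⟨q', hqp', rfl⟩, hsub'⟩, hmax'⟩ := id hT'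
  have hpint : p ∉ intrinsicInterior ℝ F :=
    notMem_intrinsicInterior_of_vertex hF (by omega) hp
  have hq := right_mem_segment ℝ p q
  have hq' := right_mem_segment ℝ p q'
  have hpF := hTF (left_mem_segment ℝ p q)
  have hlev := (hsub hq).2.2
  obtain ⟨c, hc⟩ := hω.exists_sub_eq_smul_sub hF h2 hpF (hTF hq) (hTF' hq') hqp
    hlev (hsub' hq').2.2
  have hincl : ∀ {u v : Space3} {r : ℝ}, 0 ≤ r → r ≤ 1 → v - p = r • (u - p) →
      segment ℝ p v ⊆ segment ℝ p u := by
    intro u v r h0 h1 h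
    refine (convex_segment p u).segment_subset (left_mem_segment ℝ p u) ?_
    rw [segment_eq_image']
    exact ⟨r, ⟨h0, h1⟩, by simp only [← h]; abel⟩
  rcases lt_trichotomy c 0 with hneg | h0 | hpos
  · -- then `p` would lie between interior points of the face
    exfalso
    obtain ⟨z, hz, hzF⟩ :=
      hω.exists_mem_segment_intrinsicInterior hF hqp.symm hTF hlev.symm
    rw [segment_eq_image'] at hz
    obtain ⟨s, ⟨hs0, hs1⟩, rfl⟩ := hz
    have hsc : 0 < s - c := by linarith
    have := (convex_cell hF).add_smul_mem_intrinsicInterior hzF (hTF' hq') (t := s / (s - c))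
      (by positivity) ((div_lt_one hsc).2 (by linarith))
    apply hpint
    convert this using 1
    have hq'' : q' = p + c • (q - p) := by rw [← hc]; abel
    have h4 : s / (s - c) * (s - c) = s := div_mul_cancel₀ _ hsc.ne'
    generalize s / (s - c) = r at h4
    rw [hq'']
    have h5 : p + s • (q - p) + r • (p + c • (q - p) - (p + s • (q - p))) =
        p + (s - r * (s - c)) • (q - p) := by module
    simp only [h5, h4, sub_self, zero_smul, add_zero]
  · rw [h0, zero_smul] at hc
    exact absurd (sub_eq_zero.1 hc) hqp'
  · rcases le_total c 1 with h1 | h1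
    · have hle := hincl hpos.le h1 hc
      exact (hmax' ⟨⟨q, hqp, rfl⟩, hsub⟩ hle).antisymm hle
    · have hc' : q - p = c⁻¹ • (q' - p) := by rw [hc, inv_smul_smul₀ hpos.ne']
      have hle := hincl (inv_nonneg.2 hpos.le) (inv_le_one_of_one_le₀ h1) hc'
      exact hle.antisymm (hmax ⟨⟨q', hqp', rfl⟩, hsub'⟩ hle)

/-- The segments cut by the leaf through a vertex correspond to the faces that it crosses. -/
theorem ncard_cutSegments (hω : M.IsGeneric ω) (hp : p ∈ M.vertices) :
    (M.cutSegments ω p).ncard = (M.facesCut ω p).ncard := by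
  choose f hf hsub using fun T (hT : T ∈ M.cutSegments ω p) =>
    exists_mem_facesCut_of_mem_cutSegments hω hT
  refine Set.ncard_congr f hf (fun T T' hT hT' h => ?_) (fun F hF => ?_)
  · exact eq_of_mem_cutSegments hω hp (hf T hT).1 (hf T hT).2.1 hT hT' (hsub T hT) (h ▸ hsub T' hT')
  · obtain ⟨T, hT, hTF⟩ := exists_mem_cutSegments_of_mem_facesCut hp hF
    refine ⟨T, hT, ?_⟩
    obtain ⟨⟨⟨q, hqp, rfl⟩, hs⟩, -⟩ := id hT
    obtain ⟨z, hz, hzF⟩ := hω.exists_mem_segment_intrinsicInterior hF.1 hqp.symm hTF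
      (hs (right_mem_segment ℝ p q)).2.2.symm
    exact (face_eq_of_mem_intrinsicInterior (hf _ hT).1 hF.1 hF.2.1 (hsub _ hT hz) hzF).symm

/-! ### The vertices of a face crossed by their leaf -/

/-- A generic form attains its maximum over a face at a single point, which is a vertex. -/
theorem IsGeneric.exists_unique_max (hω : M.IsGeneric ω) (hF : F ∈ M.cells) :
    ∃ v ∈ M.verticesOf F, (∀ x ∈ F, ω x ≤ ω v) ∧ ∀ x ∈ F, ω x = ω v → x = v := by
  obtain ⟨v, hv, hmax⟩ := (isCompact_cell hF).exists_isMaxOn (nonempty_cell hF)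
    (LinearMap.continuous_of_finiteDimensional ω).continuousOn
  have hmax' : ∀ x ∈ F, ω x ≤ ω v := fun x hx => hmax hx
  have hvert : ∀ x ∈ F, ω x = ω v → x ∈ M.verticesOf F := by
    intro x hx hxv
    obtain ⟨D, hD, hDF, hxD⟩ := exists_mem_intrinsicInterior hF hx
    have hconst := eq_of_isMaxOn_intrinsicInterior ω hxD fun y hy => hxv ▸ hmax' y (hDF hy)
    have hle := cellDim_le_two hD
    have h0 : cellDim D = 0 := by
      have h1 : cellDim D ≠ 1 := fun h => hω D hD h ⟨ω x, hconst⟩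
      have h2' : cellDim D ≠ 2 := fun h => hω.not_const_face hD h _ hconst
      omega
    obtain ⟨p, hp, rfl⟩ := exists_eq_singleton hD h0
    have hxp := intrinsicInterior_subset hxD
    rw [Set.mem_singleton_iff] at hxp
    subst hxp
    exact ⟨hp, hx⟩
  refine ⟨v, hvert v hv rfl, hmax', fun x hx hxv => ?_⟩
  by_contra hne
  refine (infinite_segment hne) ((verticesOf_finite hF).subset fun z hz => ?_)
  exact hvert z ((convex_cell hF).segment_subset hx hv hz) (apply_eq_of_mem_segment ω hxv rfl hz)

/-- The leaf through a vertex of a face crosses the face unless the vertex is the highest or the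
lowest one. -/
theorem ncard_crossed_vertices (hω : M.IsGeneric ω) (hF : F ∈ M.cells) (h2 : cellDim F = 2) :
    {p ∈ M.vertices | F ∈ M.facesCut ω p}.ncard + 2 = (M.verticesOf F).ncard := by
  obtain ⟨v, hv, hvmax, hvuniq⟩ := hω.exists_unique_max hF
  obtain ⟨w, hw, hwmax, hwuniq⟩ := hω.neg.exists_unique_max hF
  have hwmin : ∀ x ∈ F, ω w ≤ ω x := fun x hx => by simpa using hwmax x hx
  have hvw : v ≠ w := by
    rintro rfl
    exact hω.not_const_face hF h2 (ω v) fun x hx => (hvmax x hx).antisymm (hwmin x hx)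
  have hset : {p ∈ M.vertices | F ∈ M.facesCut ω p} = M.verticesOf F \ {v, w} := by
    ext p
    constructor
    · rintro ⟨hp, -, -, hpF, ⟨x, hx, hxp⟩, ⟨y, hy, hyp⟩⟩
      refine ⟨⟨hp, hpF⟩, ?_⟩
      rintro (rfl | rfl)
      · exact (hvmax y hy).not_gt hyp
      · exact (hwmin x hx).not_gt hxp
    · rintro ⟨⟨hp, hpF⟩, hne⟩
      simp only [Set.mem_insert_iff, Set.mem_singleton_iff, not_or] at hne
      refine ⟨hp, hF, h2, hpF, ⟨w, hw.2, lt_of_le_of_ne (hwmin p hpF) fun h => hne.2 ?_⟩,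
        ⟨v, hv.2, lt_of_le_of_ne (hvmax p hpF) fun h => hne.1 (hvuniq p hpF h)⟩⟩
      exact hwuniq p hpF (by simp [h])
  have hsub : ({v, w} : Set Space3) ⊆ M.verticesOf F := by
    rintro x (rfl | rfl)
    · exact hv
    · exact hw
  rw [hset, ← Set.ncard_pair hvw]
  exact Set.ncard_sdiff_add_ncard_of_subset hsub (verticesOf_finite hF)

end EmbeddedPolyhedron

/-! ### Double counting modulo a free action -/

open scoped Pointwise

/-- `S` is a transversal of the `G`-invariant set `A`: it meets each orbit in `A` once, and the
stabilizers of its elements are trivial. The field `eq_zero` expresses both uniqueness in the orbit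
and triviality of the stabilizers. -/
structure IsFreeTransversal (G : Type*) {α : Type*} [AddGroup G] [AddAction G α] (A S : Set α) :
    Prop where
  subset : S ⊆ A
  vadd_mem : ∀ (g : G), ∀ a ∈ A, g +ᵥ a ∈ A
  exists_vadd_eq : ∀ a ∈ A, ∃ g : G, ∃ s ∈ S, g +ᵥ s = a
  eq_zero : ∀ s ∈ S, ∀ (g : G), g +ᵥ s ∈ S → g = 0

/-- The incidences between two sets with free actions can be counted, orbit by orbit, from either
side. -/
theorem IsFreeTransversal.sum_ncard_eq_sum_ncard {G α β : Type*} [AddGroup G] [AddAction G α]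
    [AddAction G β] {A : Set α} {B : Set β} {S : Finset α} {T : Finset β}
    (hS : IsFreeTransversal G A S) (hT : IsFreeTransversal G B T) (R : α → β → Prop)
    (hR : ∀ (g : G) a b, R a b → R (g +ᵥ a) (g +ᵥ b)) (hA : ∀ a ∈ A, {b ∈ B | R a b}.Finite)
    (hB : ∀ b ∈ B, {a ∈ A | R a b}.Finite) :
    ∑ a ∈ S, {b ∈ B | R a b}.ncard = ∑ b ∈ T, {a ∈ A | R a b}.ncard := by
  have hfA : ∀ a : S, Finite {b ∈ B | R a b} := fun a => hA a (hS.subset a.2)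
  have hfB : ∀ b : T, Finite {a ∈ A | R a b} := fun b => hB b (hT.subset b.2)
  rw [← Finset.sum_coe_sort S, ← Finset.sum_coe_sort T]
  simp only [← Nat.card_coe_set_eq]
  rw [← Nat.card_sigma, ← Nat.card_sigma]
  choose γ τ hτ hγ using fun b : B => hT.exists_vadd_eq b b.2
  have hγ' : ∀ b : B, -γ b +ᵥ (b : β) = τ b := fun b => by
    rw [← hγ b, neg_vadd_vadd]
  refine Nat.card_congr (Equiv.ofBijective
    (fun x : Σ a : S, {b ∈ B | R a b} =>
      (⟨⟨τ ⟨x.2, x.2.2.1⟩, hτ _⟩, ⟨-γ ⟨x.2, x.2.2.1⟩ +ᵥ (x.1 : α),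
        hS.vadd_mem _ _ (hS.subset x.1.2), by
          have := hR (-γ ⟨x.2, x.2.2.1⟩) _ _ x.2.2.2
          rwa [hγ' ⟨x.2, x.2.2.1⟩] at this⟩⟩ : Σ b : T, {a ∈ A | R a b})) ⟨?_, ?_⟩)
  · rintro ⟨⟨a, ha⟩, ⟨b, hb, hab⟩⟩ ⟨⟨a', ha'⟩, ⟨b', hb', hab'⟩⟩ h
    simp only [Sigma.mk.injEq, Subtype.mk.injEq] at h
    obtain ⟨h1, h2⟩ := h
    have h3 : -γ ⟨b, hb⟩ +ᵥ a = -γ ⟨b', hb'⟩ +ᵥ a' := by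
      have hset : {x ∈ A | R x (τ ⟨b, hb⟩)} = {x ∈ A | R x (τ ⟨b', hb'⟩)} := by rw [h1]
      exact (Subtype.heq_iff_coe_eq (fun x => by
        exact Set.ext_iff.1 hset x)).1 h2
    have h4 : (γ ⟨b', hb'⟩ + -γ ⟨b, hb⟩) +ᵥ a = a' := by
      rw [add_vadd, h3, vadd_neg_vadd]
    have h5 := hS.eq_zero a ha _ (h4 ▸ ha')
    have h6 : γ ⟨b', hb'⟩ = γ ⟨b, hb⟩ := by
      rwa [← sub_eq_add_neg, sub_eq_zero] at h5
    have ha1 : a = a' := by rw [← h4, h5, zero_vadd]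
    have hb1 : b = b' := by
      calc b = γ ⟨b, hb⟩ +ᵥ τ ⟨b, hb⟩ := (hγ ⟨b, hb⟩).symm
        _ = γ ⟨b', hb'⟩ +ᵥ τ ⟨b', hb'⟩ := by rw [h6, h1]
        _ = b' := hγ ⟨b', hb'⟩
    subst ha1 hb1
    rfl
  · rintro ⟨⟨t, ht⟩, ⟨a, ha, hat⟩⟩
    obtain ⟨g, s, hs, rfl⟩ := hS.exists_vadd_eq a ha
    have hbB : -g +ᵥ t ∈ B := hT.vadd_mem _ _ (hT.subset ht)
    have hRb : R s (-g +ᵥ t) := by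
      have := hR (-g) _ _ hat
      rwa [neg_vadd_vadd] at this
    have h1 : (-γ ⟨-g +ᵥ t, hbB⟩ + -g) +ᵥ t = τ ⟨-g +ᵥ t, hbB⟩ := by
      rw [add_vadd]; exact hγ' ⟨-g +ᵥ t, hbB⟩
    have h2 := hT.eq_zero t ht _ (by rw [h1]; exact hτ _)
    have h3 : -γ ⟨-g +ᵥ t, hbB⟩ = g := by
      rwa [← sub_eq_add_neg, sub_eq_zero] at h2
    have h4 : τ ⟨-g +ᵥ t, hbB⟩ = t := by rw [← h1, h2, zero_vadd]
    refine ⟨⟨⟨s, hs⟩, ⟨-g +ᵥ t, hbB, hRb⟩⟩, ?_⟩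
    simp only [h3]
    congr 1
    · simp only [h4]
    · exact (Subtype.heq_iff_coe_eq (fun x => by rw [h4])).2 rfl

/-! ### Cells modulo the lattice -/

theorem exists_norm_vadd_le (Γ : Submodule ℤ Space3) [DiscreteTopology Γ] [IsZLattice ℝ Γ] :
    ∃ ρ : ℝ, ∀ x : Space3, ∃ γ : Γ, ‖γ +ᵥ x‖ ≤ ρ := by
  let b := (Module.Free.chooseBasis ℤ Γ).ofZLatticeBasis ℝ Γ
  obtain ⟨ρ, hρ⟩ := (ZSpan.fundamentalDomain_isBounded b).subset_closedBall (0 : Space3)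
  refine ⟨ρ, fun x => ?_⟩
  obtain ⟨⟨v, hv⟩, hvx, -⟩ := ZSpan.exist_unique_vadd_mem_fundamentalDomain b x
  have hvΓ : v ∈ Γ := by
    rw [← (Module.Free.chooseBasis ℤ Γ).ofZLatticeBasis_span ℝ]
    exact hv
  exact ⟨⟨v, hvΓ⟩, mem_closedBall_zero_iff.1 (hρ hvx)⟩

namespace EmbeddedPolyhedron

variable {M : EmbeddedPolyhedron} {Γ : Submodule ℤ Space3} {C D F : Set Space3} {p x : Space3}
  {ω : Space3 →ₗ[ℝ] ℝ} {r : ℕ}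

theorem mem_vadd_set_iff (γ : Γ) : γ +ᵥ x ∈ γ +ᵥ C ↔ x ∈ C :=
  Set.vadd_mem_vadd_set_iff

theorem IsInvariant.vadd_mem (hM : M.IsInvariant Γ) (γ : Γ) (hC : C ∈ M.cells) :
    γ +ᵥ C ∈ M.cells :=
  hM γ γ.2 C hC

theorem IsInvariant.vadd_vertex_mem (hM : M.IsInvariant Γ) (γ : Γ) (hp : p ∈ M.vertices) :
    γ +ᵥ p ∈ M.vertices := by
  have := hM.vadd_mem γ hp
  rwa [Set.vadd_set_singleton] at this

theorem cellDim_vadd (γ : Γ) (C : Set Space3) : cellDim (γ +ᵥ C) = cellDim C := by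
  have : vectorSpan ℝ (γ +ᵥ C) = vectorSpan ℝ C := vectorSpan_vadd ℝ C (γ : Space3)
  rw [cellDim, cellDim, this]

theorem intrinsicInterior_vadd (γ : Γ) (C : Set Space3) :
    intrinsicInterior ℝ (γ +ᵥ C) = γ +ᵥ intrinsicInterior ℝ C :=
  AffineIsometry.intrinsicInterior_image
    (AffineIsometryEquiv.constVAdd ℝ Space3 (γ : Space3)).toAffineIsometry C

/-- The translation action on cells is free: a cell invariant under a nonzero translation would be
unbounded. -/
theorem eq_zero_of_vadd_eq (hC : C ∈ M.cells) (γ : Γ) (h : γ +ᵥ C = C) : γ = 0 := by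
  by_contra hne
  have hγ : (γ : Space3) ≠ 0 := fun h => hne (Subtype.ext h)
  obtain ⟨x, hx⟩ := nonempty_cell hC
  obtain ⟨R, hR⟩ := (isCompact_cell hC).isBounded.subset_closedBall x
  have hmem : ∀ n : ℕ, (n : ℝ) • (γ : Space3) + x ∈ C := by
    intro n
    induction n with
    | zero => simpa using hx
    | succ n ih =>
      have h1 := (mem_vadd_set_iff γ).2 ih
      rw [h] at h1
      convert h1 using 1
      change _ = (γ : Space3) + ((n : ℝ) • (γ : Space3) + x)
      push_cast
      module
  obtain ⟨n, hn⟩ := exists_nat_gt (R / ‖(γ : Space3)‖)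
  have h1 := hR (hmem n)
  rw [Metric.mem_closedBall, dist_eq_norm, add_sub_cancel_right, norm_smul, Real.norm_natCast] at h1
  rw [div_lt_iff₀ (norm_pos_iff.2 hγ)] at hn
  linarith

theorem mkQ_image_vadd (γ : Γ) (C : Set Space3) : Γ.mkQ '' (γ +ᵥ C) = Γ.mkQ '' C := by
  change Γ.mkQ '' ((fun x => (γ : Space3) + x) '' C) = _
  rw [Set.image_image]
  refine Set.image_congr' fun x => ?_
  rw [map_add]
  simp

/-- Cells of the same degree with the same image in the torus are translates of each other. -/
theorem exists_vadd_eq_of_mkQ_image_eq (hM : M.IsInvariant Γ) (hC : C ∈ M.cells)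
    (hD : D ∈ M.cells) (hdim : cellDim C = cellDim D) (h : Γ.mkQ '' C = Γ.mkQ '' D) :
    ∃ γ : Γ, γ +ᵥ C = D := by
  obtain ⟨x, hx⟩ := intrinsicInterior_cell_nonempty hC
  obtain ⟨y, hy, hyx⟩ : Γ.mkQ x ∈ Γ.mkQ '' D := h ▸ ⟨x, intrinsicInterior_subset hx, rfl⟩
  have hmem : y - x ∈ Γ := by
    rw [← Submodule.Quotient.eq]
    exact hyx
  let γ : Γ := ⟨y - x, hmem⟩
  have hγ : γ +ᵥ x = y := sub_add_cancel y x
  have hyC : y ∈ intrinsicInterior ℝ (γ +ᵥ C) := by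
    rw [intrinsicInterior_vadd, ← hγ, mem_vadd_set_iff]
    exact hx
  refine ⟨γ, eq_of_subset_of_cellDim_le hD (hM.vadd_mem γ hC)
    (subset_of_mem_intrinsicInterior hD (hM.vadd_mem γ hC) hy hyC) ?_⟩
  rw [cellDim_vadd, hdim]

theorem quotientCells_finite [DiscreteTopology Γ] [IsZLattice ℝ Γ] (hM : M.IsInvariant Γ) (r : ℕ) :
    (M.quotientCells Γ r).Finite := by
  obtain ⟨ρ, hρ⟩ := exists_norm_vadd_le Γ
  refine ((finite_cells_meeting (M := M) (isCompact_closedBall (0 : Space3) ρ)).image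
    (fun C => Γ.mkQ '' C)).subset ?_
  rintro _ ⟨C, ⟨hC, -⟩, rfl⟩
  obtain ⟨x, hx⟩ := nonempty_cell hC
  obtain ⟨γ, hγ⟩ := hρ x
  exact ⟨γ +ᵥ C, ⟨hM.vadd_mem γ hC, γ +ᵥ x, (mem_vadd_set_iff γ).2 hx, by simpa using hγ⟩,
    mkQ_image_vadd γ C⟩

theorem exists_cell_transversal [DiscreteTopology Γ] [IsZLattice ℝ Γ] (hM : M.IsInvariant Γ)
    (r : ℕ) : ∃ T : Finset (Set Space3), IsFreeTransversal Γ {C ∈ M.cells | cellDim C = r} T ∧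
      T.card = (M.quotientCells Γ r).ncard := by
  classical
  have hfin := quotientCells_finite (Γ := Γ) hM r
  choose! c hc hcq using fun q (hq : q ∈ M.quotientCells Γ r) => hq
  refine ⟨hfin.toFinset.image c, ⟨?_, ?_, ?_, ?_⟩, ?_⟩
  · intro C hC
    simp only [Finset.coe_image, Set.Finite.coe_toFinset] at hC
    obtain ⟨q, hq, rfl⟩ := hC
    exact hc q hq
  · rintro γ C ⟨hC, hCr⟩
    exact ⟨hM.vadd_mem γ hC, by rw [cellDim_vadd, hCr]⟩
  · rintro C ⟨hC, hCr⟩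
    have hq : Γ.mkQ '' C ∈ M.quotientCells Γ r := ⟨C, ⟨hC, hCr⟩, rfl⟩
    obtain ⟨γ, hγ⟩ := exists_vadd_eq_of_mkQ_image_eq hM (hc _ hq).1 hC
      (by rw [(hc _ hq).2, hCr]) (hcq _ hq)
    exact ⟨γ, c (Γ.mkQ '' C), by simpa using ⟨_, hq, rfl⟩, hγ⟩
  · intro C hC γ hγC
    simp only [Finset.coe_image, Set.Finite.coe_toFinset] at hC hγC
    obtain ⟨q, hq, rfl⟩ := hC
    obtain ⟨q', hq', h⟩ := hγC
    have hqq : q' = q := by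
      rw [← hcq q hq, ← hcq q' hq', h]
      exact mkQ_image_vadd γ _
    subst hqq
    exact eq_zero_of_vadd_eq (hc _ hq).1 γ h.symm
  · rw [Set.ncard_eq_toFinset_card _ hfin]
    refine Finset.card_image_of_injOn fun q hq q' hq' h => ?_
    rw [Set.Finite.coe_toFinset] at hq hq'
    rw [← hcq q hq, ← hcq q' hq', h]

theorem IsVertexTransversal.isFreeTransversal (hM : M.IsInvariant Γ) {S : Set Space3}
    (hS : M.IsVertexTransversal Γ S) : IsFreeTransversal Γ M.vertices S where
  subset := hS.1
  vadd_mem γ _ hp := hM.vadd_vertex_mem γ hp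
  exists_vadd_eq v hv := by
    obtain ⟨p, ⟨hp, hvp⟩, -⟩ := hS.2 v hv
    exact ⟨⟨v - p, hvp⟩, p, hp, sub_add_cancel v p⟩
  eq_zero s hs γ hγ := by
    obtain ⟨p, -, huniq⟩ := hS.2 (γ +ᵥ s) (hS.1 hγ)
    have h1 := huniq (γ +ᵥ s) ⟨hγ, by simp⟩
    have h2 := huniq s ⟨hs, by
      change (γ : Space3) + s - s ∈ Γ
      rw [add_sub_cancel_right]
      exact γ.2⟩
    have h3 : (γ : Space3) + s = s := h1.trans h2.symm
    exact Subtype.ext (by simpa using h3)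

theorem IsVertexTransversal.bijOn {S : Set Space3}
    (hS : M.IsVertexTransversal Γ S) :
    Set.BijOn (fun p => Γ.mkQ '' {p}) S (M.quotientCells Γ 0) := by
  refine ⟨fun p hp => ⟨{p}, ⟨hS.1 hp, cellDim_singleton p⟩, rfl⟩, fun p hp q hq h => ?_, ?_⟩
  · simp only [Set.image_singleton, Set.singleton_eq_singleton_iff] at h
    have hmem : p - q ∈ Γ := (Submodule.Quotient.eq Γ).1 h
    obtain ⟨s, -, huniq⟩ := hS.2 p (hS.1 hp)
    rw [huniq p ⟨hp, by simp⟩, huniq q ⟨hq, hmem⟩]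
  · rintro _ ⟨C, ⟨hC, h0⟩, rfl⟩
    obtain ⟨v, hv, rfl⟩ := exists_eq_singleton hC h0
    obtain ⟨p, ⟨hp, hvp⟩, -⟩ := hS.2 v hv
    refine ⟨p, hp, ?_⟩
    simp only [Set.image_singleton, Set.singleton_eq_singleton_iff]
    exact ((Submodule.Quotient.eq Γ).2 hvp).symm

theorem IsVertexTransversal.finite [DiscreteTopology Γ] [IsZLattice ℝ Γ] (hM : M.IsInvariant Γ)
    {S : Set Space3} (hS : M.IsVertexTransversal Γ S) : S.Finite :=
  (hS.bijOn).finite_iff_finite.2 (quotientCells_finite hM 0)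

theorem exists_isVertexTransversal (M : EmbeddedPolyhedron) (Γ : Submodule ℤ Space3) :
    ∃ S, M.IsVertexTransversal Γ S := by
  -- choose a representative in each class that contains a vertex
  choose! c hc hcq using fun q (hq : q ∈ Γ.mkQ '' M.vertices) => hq
  have hmem : ∀ v ∈ M.vertices, Γ.mkQ v ∈ Γ.mkQ '' M.vertices := fun v hv => ⟨v, hv, rfl⟩
  refine ⟨c '' (Γ.mkQ '' M.vertices), ?_, fun v hv => ⟨c (Γ.mkQ v), ⟨⟨_, hmem v hv, rfl⟩, ?_⟩, ?_⟩⟩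
  · rintro _ ⟨q, hq, rfl⟩
    exact hc q hq
  · exact (Submodule.Quotient.eq Γ).1 (hcq _ (hmem v hv)).symm
  · rintro _ ⟨⟨q, hq, rfl⟩, hvq⟩
    have h1 : Γ.mkQ v = Γ.mkQ (c q) := (Submodule.Quotient.eq Γ).2 hvq
    rw [h1, hcq q hq]

/-! ### The index sum over a transversal -/

theorem vadd_mem_facesCut (hM : M.IsInvariant Γ) (γ : Γ) (hF : F ∈ M.facesCut ω p) :
    γ +ᵥ F ∈ M.facesCut ω (γ +ᵥ p) := by
  obtain ⟨hF, h2, hp, ⟨x, hx, hxp⟩, ⟨y, hy, hyp⟩⟩ := hF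
  have hω : ∀ z : Space3, ω (γ +ᵥ z) = ω γ + ω z := fun z => map_add ω (γ : Space3) z
  refine ⟨hM.vadd_mem γ hF, by rw [cellDim_vadd, h2], (mem_vadd_set_iff γ).2 hp,
    ⟨γ +ᵥ x, (mem_vadd_set_iff γ).2 hx, ?_⟩, ⟨γ +ᵥ y, (mem_vadd_set_iff γ).2 hy, ?_⟩⟩
  · rw [hω, hω]; linarith
  · rw [hω, hω]; linarith

theorem index_eq (hω : M.IsGeneric ω) (hp : p ∈ M.vertices) :
    M.index ω p = 1 - ((M.facesCut ω p).ncard : ℝ) / 2 := by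
  rw [index, ncard_cutSegments hω hp]

theorem index_vadd (hM : M.IsInvariant Γ) (hω : M.IsGeneric ω) (γ : Γ) (hp : p ∈ M.vertices) :
    M.index ω (γ +ᵥ p) = M.index ω p := by
  rw [index_eq hω hp, index_eq hω (hM.vadd_vertex_mem γ hp)]
  congr 3
  symm
  refine Set.ncard_congr (fun F _ => γ +ᵥ F) (fun F hF => vadd_mem_facesCut hM γ hF)
    (fun F F' _ _ h => vadd_left_cancel γ h) (fun F hF => ⟨-γ +ᵥ F, ?_, vadd_neg_vadd γ F⟩)
  have := vadd_mem_facesCut hM (-γ) hF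
  rwa [neg_vadd_vadd] at this

theorem facesCut_finite : (M.facesCut ω p).Finite :=
  (finite_cells_containing p).subset fun _ hF => ⟨hF.1, hF.2.2.1⟩

/-- Counted from the vertices, the crossings of faces by leaves of vertices give the indices;
counted from the faces, they give the numbers of vertices, equivalently of edges, of the faces
minus two; and each edge is counted in two faces. -/
theorem sum_index_eq_quotientEulerChar [DiscreteTopology Γ] [IsZLattice ℝ Γ]
    (hM : M.IsInvariant Γ) (hω : M.IsGeneric ω) {S : Finset Space3}
    (hS : M.IsVertexTransversal Γ S) : ∑ p ∈ S, M.index ω p = (M.quotientEulerChar Γ : ℝ) := by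
  obtain ⟨E, hE, hEcard⟩ := exists_cell_transversal (Γ := Γ) hM 1
  obtain ⟨T, hT, hTcard⟩ := exists_cell_transversal (Γ := Γ) hM 2
  have hScard : S.card = (M.quotientCells Γ 0).ncard := by
    rw [← Set.ncard_coe_finset S]
    exact (hS.bijOn).ncard_eq
  have h1 := (hS.isFreeTransversal hM).sum_ncard_eq_sum_ncard hT (fun p F => F ∈ M.facesCut ω p)
    (fun γ p F h => vadd_mem_facesCut hM γ h)
    (fun p _ => facesCut_finite.subset fun F hF => hF.2)
    (fun F hF => (verticesOf_finite hF.1).subset fun p hp => ⟨hp.1, hp.2.2.2.1⟩)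
  have h2 := hE.sum_ncard_eq_sum_ncard hT (fun e F => e ⊆ F)
    (fun γ e F h => Set.vadd_set_mono h)
    (fun e he => (facesOver_finite he.1).subset fun F hF => ⟨hF.1.1, hF.1.2, hF.2⟩)
    (fun F hF => (finite_subcells hF.1).subset fun e he => ⟨he.1.1, he.2⟩)
  have h3 : ∑ e ∈ E, {F ∈ {C ∈ M.cells | cellDim C = 2} | e ⊆ F}.ncard = E.card * 2 := by
    refine Finset.sum_const_nat fun e he => ?_
    have he' := hE.subset he
    exact (congrArg Set.ncard (Set.ext fun F => and_assoc)).trans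
      (ncard_facesOver_edge he'.1 he'.2)
  have h4 : ∀ F ∈ T, {p ∈ M.vertices | F ∈ M.facesCut ω p}.ncard + 2 =
      {e ∈ {C ∈ M.cells | cellDim C = 1} | e ⊆ F}.ncard := by
    intro F hF
    have hF' := hT.subset hF
    rw [ncard_crossed_vertices hω hF'.1 hF'.2, ← ncard_edgesOf_eq_ncard_verticesOf hF'.1 hF'.2]
    congr 1
    ext e
    exact and_assoc.symm
  have h5 : ∑ p ∈ S, (M.facesCut ω p).ncard + T.card * 2 = E.card * 2 := by
    rw [← h3, h2, ← Finset.sum_congr rfl h4, Finset.sum_add_distrib, ← h1, Finset.sum_const,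
      smul_eq_mul]
    congr 1
    refine Finset.sum_congr rfl fun p _ => ?_
    congr 1
    ext F
    exact ⟨fun h => ⟨⟨h.1, h.2.1⟩, h⟩, fun h => h.2⟩
  rw [Finset.sum_congr rfl fun p hp => index_eq hω (hS.1 hp), Finset.sum_sub_distrib,
    ← Finset.sum_div, quotientEulerChar, ← hScard, ← hEcard, ← hTcard]
  have h6 : (∑ p ∈ S, ((M.facesCut ω p).ncard : ℝ)) + T.card * 2 = E.card * 2 := by
    exact_mod_cast h5
  push_cast
  simp only [Finset.sum_const, nsmul_eq_mul, mul_one]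
  linarith

end EmbeddedPolyhedron

/-! ### Lattice points in large balls -/

section Lattice

variable (Γ : Submodule ℤ Space3)

instance : MeasurableConstVAdd Γ Space3 :=
  ⟨fun γ => measurable_const_add (γ : Space3)⟩

instance : VAddInvariantMeasure Γ Space3 volume :=
  ⟨fun γ s _ => measure_preimage_add volume (γ : Space3) s⟩

theorem finite_norm_vadd_lt [DiscreteTopology Γ] (x : Space3) (r : ℝ) :
    {γ : Γ | ‖γ +ᵥ x‖ < r}.Finite := by
  have hcl : IsClosed (Γ : Set Space3) :=
    AddSubgroup.isClosed_of_discrete (H := Γ.toAddSubgroup)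
  have hdisc : DiscreteTopology (Γ : Set Space3) := ‹DiscreteTopology Γ›
  have hfin := Metric.finite_isBounded_inter_isClosed (s := (Γ : Set Space3)) hdisc.isDiscrete
    (Metric.isBounded_ball (x := -x) (r := r)) hcl
  refine Set.Finite.of_finite_image (f := fun γ : Γ => (γ : Space3)) (hfin.subset ?_)
    Subtype.val_injective.injOn
  rintro _ ⟨γ, hγ, rfl⟩
  refine ⟨?_, γ.2⟩
  rw [Metric.mem_ball, dist_eq_norm, sub_neg_eq_add]
  exact hγ

theorem isClosed_dirichletDomain : IsClosed (dirichletDomain Γ) := by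
  have : dirichletDomain Γ = ⋂ γ ∈ Γ, {x | dist x 0 ≤ dist x γ} := by
    ext x; simp [dirichletDomain]
  rw [this]
  exact isClosed_biInter fun γ _ =>
    isClosed_le (continuous_id.dist continuous_const) (continuous_id.dist continuous_const)

theorem exists_vadd_mem_dirichletDomain [DiscreteTopology Γ] (x : Space3) :
    ∃ γ : Γ, γ +ᵥ x ∈ dirichletDomain Γ := by
  obtain ⟨g, hg, hmin⟩ := Set.exists_min_image _ (fun γ : Γ => ‖γ +ᵥ x‖)
    (finite_norm_vadd_lt Γ x (‖x‖ + 1)) ⟨0, by simp⟩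
  refine ⟨g, fun γ hγ => ?_⟩
  have hsub : dist (g +ᵥ x) γ = ‖(g - ⟨γ, hγ⟩ : Γ) +ᵥ x‖ := by
    rw [dist_eq_norm]
    congr 1
    change (g : Space3) + x - γ = ((g : Space3) - γ) + x
    abel
  rw [dist_zero_right, hsub]
  by_cases h : ‖(g - ⟨γ, hγ⟩ : Γ) +ᵥ x‖ < ‖x‖ + 1
  · exact hmin _ h
  · exact (hg.le.trans (not_lt.1 h))

/-- The translates of the Dirichlet domain overlap only in perpendicular bisectors. -/
theorem isAddFundamentalDomain_dirichletDomain [DiscreteTopology Γ] :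
    IsAddFundamentalDomain Γ (dirichletDomain Γ) (volume : Measure Space3) where
  nullMeasurableSet := (isClosed_dirichletDomain Γ).measurableSet.nullMeasurableSet
  ae_covers := Eventually.of_forall (exists_vadd_mem_dirichletDomain Γ)
  aedisjoint := by
    intro g h hgh
    have key : ∀ g h : Γ, ∀ x ∈ g +ᵥ dirichletDomain Γ, dist x g ≤ dist x h := by
      rintro g h _ ⟨d, hd, rfl⟩
      have h1 := hd (h - g) (h - g).2
      have e1 : dist ((g : Space3) + d) g = dist d 0 := by
        simp [dist_eq_norm]
      have e2 : dist ((g : Space3) + d) h = dist d ((h - g : Γ) : Space3) := by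
        rw [dist_eq_norm, dist_eq_norm]
        congr 1
        push_cast
        abel
      change dist ((g : Space3) + d) g ≤ dist ((g : Space3) + d) h
      rw [e1, e2]
      exact h1
    have hsub : (g +ᵥ dirichletDomain Γ) ∩ (h +ᵥ dirichletDomain Γ) ⊆
        (AffineSubspace.perpBisector (g : Space3) (h : Space3) : Set Space3) := by
      rintro x ⟨hx1, hx2⟩
      rw [SetLike.mem_coe, AffineSubspace.mem_perpBisector_iff_dist_eq]
      exact (key g h x hx1).antisymm (key h g x hx2)
    refine measure_mono_null hsub (Measure.addHaar_affineSubspace volume _ ?_)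
    rw [Ne, AffineSubspace.perpBisector_eq_top]
    exact fun h' => hgh (Subtype.ext h')

theorem exists_norm_le_of_mem_dirichletDomain [DiscreteTopology Γ] [IsZLattice ℝ Γ] :
    ∃ ρ : ℝ, ∀ x ∈ dirichletDomain Γ, ‖x‖ ≤ ρ := by
  obtain ⟨ρ, hρ⟩ := exists_norm_vadd_le Γ
  refine ⟨ρ, fun x hx => ?_⟩
  obtain ⟨γ, hγ⟩ := hρ x
  have h1 := hx (-γ) (-γ).2
  rw [dist_zero_right, dist_eq_norm] at h1
  refine h1.trans (le_of_eq_of_le ?_ hγ)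
  congr 1
  change x - ((-γ : Γ) : Space3) = (γ : Space3) + x
  push_cast
  abel

theorem volume_real_ball_eq {r : ℝ} (hr : 0 ≤ r) :
    volume.real (Metric.ball (0 : Space3) r) =
      r ^ 3 * volume.real (Metric.ball (0 : Space3) 1) := by
  rw [measureReal_def, Measure.addHaar_ball _ _ hr, ENNReal.toReal_mul,
    ENNReal.toReal_ofReal (by positivity), finrank_euclideanSpace_fin, measureReal_def]

/-- Each orbit of `Γ` has asymptotically one point in a ball per volume of the Dirichlet domain. -/
theorem tendsto_ncard_norm_vadd_lt [DiscreteTopology Γ] [IsZLattice ℝ Γ] (s : Space3) :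
    Tendsto (fun R : ℝ => ({γ : Γ | ‖γ +ᵥ s‖ < R}.ncard : ℝ) /
      (volume.real (Metric.ball (0 : Space3) R) / volume.real (dirichletDomain Γ)))
      atTop (𝓝 1) := by
  set D := dirichletDomain Γ with hD
  have hfd := isAddFundamentalDomain_dirichletDomain Γ
  obtain ⟨ρ, hρ⟩ := exists_norm_le_of_mem_dirichletDomain Γ
  have hDfin : volume D ≠ ⊤ := by
    refine ((Metric.isBounded_closedBall (x := (0 : Space3)) (r := ρ)).subset fun x hx => ?_).measure_lt_top.ne
    simpa using hρ x hx
  have hv : 0 < volume.real D :=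
    ENNReal.toReal_pos (hfd.measure_ne_zero (NeZero.ne _)) hDfin
  have hc : 0 < volume.real (Metric.ball (0 : Space3) 1) :=
    ENNReal.toReal_pos (Metric.measure_ball_pos _ _ one_pos).ne' measure_ball_lt_top.ne
  set v := volume.real D
  set c := volume.real (Metric.ball (0 : Space3) 1)
  set N : ℝ → ℝ := fun R => ({γ : Γ | ‖γ +ᵥ s‖ < R}.ncard : ℝ) with hN
  have hρ0 : 0 ≤ ρ := (norm_nonneg _).trans (hρ 0 (fun γ _ => by simp))
  set k := ρ + ‖s‖ with hk
  have hk0 : 0 ≤ k := by positivity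
  have hnear : ∀ (g : Γ), ∀ x ∈ g +ᵥ D, ‖x - (g +ᵥ s)‖ ≤ k := by
    rintro g _ ⟨d, hd, rfl⟩
    have : (g : Space3) + d - ((g : Space3) + s) = d - s := by abel
    change ‖(g : Space3) + d - ((g : Space3) + s)‖ ≤ k
    rw [this]
    exact (norm_sub_le _ _).trans (add_le_add_left (hρ d hd) _)
  have hvol : ∀ g : Γ, volume (g +ᵥ D) = volume D := fun g => measure_vadd volume g D
  have hsum : ∀ R, ∑ g ∈ (finite_norm_vadd_lt Γ s R).toFinset, volume (g +ᵥ D) =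
      ENNReal.ofReal (N R * v) := by
    intro R
    simp only [hvol, Finset.sum_const, hN, Set.ncard_eq_toFinset_card _ (finite_norm_vadd_lt Γ s R)]
    rw [ENNReal.ofReal_mul (by positivity), ENNReal.ofReal_natCast, nsmul_eq_mul,
      show v = (volume D).toReal from rfl, ENNReal.ofReal_toReal hDfin]
  have hupper : ∀ R, 0 ≤ R → N R * v ≤ (R + k) ^ 3 * c := by
    intro R hR
    rw [← volume_real_ball_eq (by positivity), measureReal_def,
      ← ENNReal.ofReal_le_iff_le_toReal measure_ball_lt_top.ne, ← hsum,
      hfd.measure_eq_tsum' (Metric.ball 0 (R + k))]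
    refine le_trans (Finset.sum_le_sum fun g hg => ?_) (ENNReal.sum_le_tsum _)
    refine measure_mono fun x hx => ⟨?_, hx⟩
    rw [Set.Finite.mem_toFinset] at hg
    have hg' : ‖g +ᵥ s‖ < R := hg
    rw [mem_ball_zero_iff]
    have h1 := norm_add_le (g +ᵥ s) (x - (g +ᵥ s))
    rw [add_sub_cancel] at h1
    have h2 := hnear g x hx
    linarith
  have hlower : ∀ R, k ≤ R → (R - k) ^ 3 * c ≤ N R * v := by
    intro R hR
    rw [← volume_real_ball_eq (by linarith), measureReal_def]
    refine ENNReal.toReal_le_of_le_ofReal (by positivity) ?_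
    rw [← hsum, hfd.measure_eq_tsum' (Metric.ball 0 (R - k)),
      tsum_eq_sum (s := (finite_norm_vadd_lt Γ s R).toFinset)]
    · exact Finset.sum_le_sum fun g _ => measure_mono Set.inter_subset_right
    · intro g hg
      have hempty : Metric.ball (0 : Space3) (R - k) ∩ (g +ᵥ D) = ∅ := by
        rw [Set.eq_empty_iff_forall_notMem]
        rintro x ⟨hx1, hx2⟩
        apply hg
        rw [Set.Finite.mem_toFinset]
        change ‖g +ᵥ s‖ < R
        rw [mem_ball_zero_iff] at hx1
        have h1 := norm_sub_le x (x - (g +ᵥ s))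
        rw [sub_sub_cancel] at h1
        have h2 := hnear g x hx2
        linarith
      rw [hempty, measure_empty]
  have hlim : ∀ a : ℝ, Tendsto (fun R : ℝ => (1 + a * R⁻¹) ^ 3) atTop (𝓝 1) := by
    intro a
    have := ((tendsto_inv_atTop_zero (𝕜 := ℝ)).const_mul a).const_add 1
    simpa using this.pow 3
  have hevpos : ∀ᶠ R : ℝ in atTop, k < R := eventually_gt_atTop k
  refine tendsto_of_tendsto_of_tendsto_of_le_of_le' (hlim (-k)) (hlim k) ?_ ?_
  · filter_upwards [hevpos] with R hR
    have hR0 : 0 < R := hk0.trans_lt hR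
    have h1 := hlower R hR.le
    rw [volume_real_ball_eq hR0.le, div_div_eq_mul_div, le_div_iff₀ (by positivity)]
    calc (1 + -k * R⁻¹) ^ 3 * (R ^ 3 * c) = (R - k) ^ 3 * c := by field_simp; ring
      _ ≤ _ := h1
  · filter_upwards [hevpos] with R hR
    have hR0 : 0 < R := hk0.trans_lt hR
    have h1 := hupper R hR0.le
    rw [volume_real_ball_eq hR0.le, div_div_eq_mul_div, div_le_iff₀ (by positivity)]
    calc N R * v ≤ (R + k) ^ 3 * c := h1
      _ = (1 + k * R⁻¹) ^ 3 * (R ^ 3 * c) := by field_simp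

end Lattice

namespace EmbeddedPolyhedron

variable {M : EmbeddedPolyhedron} {Γ : Submodule ℤ Space3} {ω : Space3 →ₗ[ℝ] ℝ}

theorem finite_vertices_norm_lt (M : EmbeddedPolyhedron) (R : ℝ) :
    {p ∈ M.vertices | ‖p‖ < R}.Finite := by
  refine Set.Finite.of_finite_image ((finite_cells_meeting (M := M)
    (isCompact_closedBall (0 : Space3) R)).subset ?_) (Set.singleton_injective.injOn)
  rintro _ ⟨p, ⟨hp, hpR⟩, rfl⟩
  exact ⟨hp, p, rfl, by simpa using hpR.le⟩

/-- The sum of the indices over a ball, grouped by classes of vertices. -/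
theorem finsum_index_ball (hM : M.IsInvariant Γ) (hω : M.IsGeneric ω) {S : Finset Space3}
    (hS : M.IsVertexTransversal Γ S) (R : ℝ) :
    ∑ᶠ p ∈ {p ∈ M.vertices | ‖p‖ < R}, M.index ω p =
      ∑ s ∈ S, M.index ω s * {γ : Γ | ‖γ +ᵥ s‖ < R}.ncard := by
  classical
  have hfin := finite_vertices_norm_lt M R
  have hT := hS.isFreeTransversal hM
  rw [finsum_mem_eq_finite_toFinset_sum _ hfin]
  choose! r hr hrv using fun v (hv : v ∈ M.vertices) => (hS.2 v hv).exists
  rw [← Finset.sum_fiberwise_of_maps_to (g := r) (t := S) fun p hp =>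
    (hr p (hfin.mem_toFinset.1 hp).1)]
  refine Finset.sum_congr rfl fun s hs => ?_
  have hrep : ∀ γ : Γ, r (γ +ᵥ s) = s := by
    intro γ
    have hv := hM.vadd_vertex_mem γ (hS.1 hs)
    refine (hS.2 _ hv).unique ⟨hr _ hv, hrv _ hv⟩ ⟨hs, ?_⟩
    change (γ : Space3) + s - s ∈ Γ
    rw [add_sub_cancel_right]
    exact γ.2
  have hcard : {γ : Γ | ‖γ +ᵥ s‖ < R}.ncard = (hfin.toFinset.filter fun p => r p = s).card := by
    rw [← Set.ncard_coe_finset]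
    refine Set.ncard_congr (fun γ _ => γ +ᵥ s) (fun γ hγ => ?_) (fun γ γ' _ _ h => ?_)
      (fun p hp => ?_)
    · simp only [Finset.coe_filter, Set.Finite.mem_toFinset]
      exact ⟨⟨hM.vadd_vertex_mem γ (hS.1 hs), hγ⟩, hrep γ⟩
    · have h' : (γ : Space3) + s = (γ' : Space3) + s := h
      exact Subtype.ext (add_right_cancel h')
    · simp only [Finset.coe_filter, Set.Finite.mem_toFinset] at hp
      obtain ⟨⟨hpv, hpR⟩, hps⟩ := hp
      have hmem := hrv p hpv
      rw [hps] at hmem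
      have hγ : (⟨p - s, hmem⟩ : Γ) +ᵥ s = p := sub_add_cancel p s
      exact ⟨⟨p - s, hmem⟩, by rw [Set.mem_ofPred_eq, hγ]; exact hpR, hγ⟩
  rw [hcard, Finset.sum_congr rfl (g := fun _ => M.index ω s), Finset.sum_const, nsmul_eq_mul,
    mul_comm]
  intro p hp
  rw [Finset.mem_filter, Set.Finite.mem_toFinset] at hp
  obtain ⟨⟨hpv, -⟩, hps⟩ := hp
  have hmem := hrv p hpv
  rw [hps] at hmem
  have hγ : (⟨p - s, hmem⟩ : Γ) +ᵥ s = p := sub_add_cancel p s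
  rw [← hγ]
  exact index_vadd hM hω _ (hS.1 hs)

end EmbeddedPolyhedron

theorem mainTheorem1 (M : EmbeddedPolyhedron) (Γ : Submodule ℤ Space3)
    [DiscreteTopology Γ] [IsZLattice ℝ Γ] (hM : M.IsInvariant Γ)
    (ω : Space3 →ₗ[ℝ] ℝ) (hω : M.IsGeneric ω) :
    (∀ r : ℕ, (M.quotientCells Γ r).Finite) ∧
    (∀ S : Set Space3, M.IsVertexTransversal Γ S →
      S.Finite ∧ ∑ᶠ p ∈ S, M.index ω p = (M.quotientEulerChar Γ : ℝ)) ∧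
    (∀ R : ℝ, {p ∈ M.vertices | ‖p‖ < R}.Finite) ∧
    Tendsto
      (fun R : ℝ => (∑ᶠ p ∈ {p ∈ M.vertices | ‖p‖ < R}, M.index ω p) /
        (volume.real (Metric.ball (0 : Space3) R) / volume.real (dirichletDomain Γ)))
      atTop (𝓝 (M.quotientEulerChar Γ : ℝ)) := by
  refine ⟨EmbeddedPolyhedron.quotientCells_finite hM, fun S hS => ?_,
    EmbeddedPolyhedron.finite_vertices_norm_lt M, ?_⟩
  · have hfin := hS.finite hM
    refine ⟨hfin, ?_⟩
    rw [finsum_mem_eq_finite_toFinset_sum _ hfin]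
    exact EmbeddedPolyhedron.sum_index_eq_quotientEulerChar hM hω (by simpa using hS)
  · obtain ⟨S, hS⟩ := EmbeddedPolyhedron.exists_isVertexTransversal M Γ
    lift S to Finset Space3 using hS.finite hM
    rw [← EmbeddedPolyhedron.sum_index_eq_quotientEulerChar hM hω hS]
    simp only [EmbeddedPolyhedron.finsum_index_ball hM hω hS, Finset.sum_div, mul_div_assoc]
    refine tendsto_finsetSum _ fun s _ => ?_
    simpa using (tendsto_ncard_norm_vadd_lt Γ s).const_mul (M.index ω s)
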